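/- Fix $\epsilon\in\{-1,1\}$. Consider the class $\mathcal K^\epsilon$ of reduced Kolmogorov equations $\mathcal K^\epsilon_B\colon u_t=\epsilon u_{xx}+B(t,x)u_x$, whose arbitrary element $B$ is a smooth function of $(t,x)$. All functions are real and smooth ($C^\infty$). A point transformation $\Phi$ is a diffeomorphism of an open set $\Omega$ of the space of $(t,x,u)$ onto its image; the projection of $\Omega$ to the $t$-axis, the set of $x$ occurring in $\Omega$ over each fixed $t$, and the set of $u$ occurring over each fixed $(t,x)$ are assumed to be intervals (every point has arbitrarily small neighbourhoods of this kind). Drifts $B$ and $\tilde B$ are defined on the projections of $\Omega$ and $\Phi(\Omega)$ to the $(t,x)$-plane. $\Phi$ connects $\mathcal K^\epsilon_B$ and $\mathcal K^\epsilon_{\tilde B}$ if the second prolongation of $\Phi$, wherever defined over $\Omega$, maps every 2-jet satisfying $\mathcal K^\epsilon_B$ to a 2-jet satisfying $\mathcal K^\epsilon_{\tilde B}$; then $(B,\Phi,\tilde B)$ is called an admissible transformation. (i) A point transformation $\Phi$ connects $\mathcal K^\epsilon_B$ and $\mathcal K^\epsilon_{\tilde B}$ if and only if its components are of the form \[\tilde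 t=T(t),\quad \tilde x=X^1(t)x+X^0(t),\quad \tilde u=U^1(t,x)u+U^0(t,x),\] where $T$, $X^0$, $X^1$ are smooth functions of $t$ with $X^1\ne0$ and $T_t=(X^1)^2$, $U^1$ and $U^0$ are smooth functions of $(t,x)$ with $U^1\ne0$ such that $1/U^1$ and $U^0/U^1$ are solutions of $\mathcal K^\epsilon_B$, and the drifts are related by \[\tilde B\bigl(T(t),X^1(t)x+X^0(t)\bigr)=\frac1{X^1}\left(B-2\epsilon\frac{U^1_x}{U^1}\right)-\frac{X^1_tx+X^0_t}{(X^1)^2}.\] The parameters are arbitrary: for every $B$ and every choice of $T,X^1,X^0,U^1,U^0$ on (the projections of) $\Omega$ subject to these conditions, the above formulas define a point transformation with domain $\Omega$ that connects $\mathcal K^\epsilon_B$ with $\mathcal K^\epsilon_{\tilde B}$ for some smooth $\tilde B$. (ii) The equivalence group of $\mathcal K^\epsilon$ is the set of point transformations of the space of $(t,x,u_{(2)},B)$, where $u_{(2)}=(u,u_t,u_x,u_{tt},u_{tx},u_{xx})$, that are projectable to the spaces of $(t,x,u)$ and of $(t,x,u_{(2)})$, are consistent with the contact structure of the space of 2-jets,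 and map every equation of $\mathcal K^\epsilon$ to an equation of $\mathcal K^\epsilon$. (Their domains are open sets $W$ whose projections to the space of $(t,x,u)$ are as above, and such that for every point of $W$, with coordinates $(t,x,u)$ and $B=b$, there is a point of $W$ with the same $(t,x,u)$ and $b$ at which $u_t=\epsilon u_{xx}+bu_x$.) A point transformation of the space of $(t,x,u_{(2)},B)$ that is projectable and consistent with the contact structure in this sense belongs to the equivalence group if and only if its $(t,x,u,B)$-components are of the form \[\tilde t=T(t),\quad \tilde x=X^1(t)x+X^0(t),\quad \tilde u=c_1u+c_2,\quad \tilde B=\frac1{X^1}B-\frac{X^1_tx+X^0_t}{(X^1)^2},\] where $T$, $X^0$, $X^1$ are smooth functions of $t$ with $X^1\ne0$ and $T_t=(X^1)^2$, and $c_1$, $c_2$ are constants with $c_1\ne0$; moreover, on every such domain $W$ all such $T,X^0,X^1,c_1,c_2$ are realized by elements of the equivalence group. -/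

import Mathlib

open Set
open scoped ContDiff

noncomputable section

namespace Kolmogorov

/-! ### Jet spaces over the space of `(t, x, u)` -/

/-- The space with coordinates `(t, x, u)`. -/
abbrev Pt : Type := ℝ × ℝ × ℝ

/-- The first-order jet space, with coordinates `((t, x, u), (u_t, u_x))`. -/
abbrev Jet1 : Type := Pt × (ℝ × ℝ)

/-- The second-order jet space, with coordinates
`(((t, x, u), (u_t, u_x)), (u_tt, u_tx, u_xx))`. -/
abbrev Jet2 : Type := Jet1 × (ℝ × ℝ × ℝ)

/-- The second-order jet space extended by the coordinate `B` of the arbitrary element. -/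
abbrev ExtJet : Type := Jet2 × ℝ

/-- The projection `(t, x, u) ↦ (t, x)`. -/
def tx (z : Pt) : ℝ × ℝ := (z.1, z.2.1)

/-- The `(t, x)`-coordinates of a second-order jet. -/
def jetTX (j : Jet2) : ℝ × ℝ := tx j.1.1

/-! ### Point transformations and their prolongation -/

/-- `Φ` is a local diffeomorphism with domain `Ω`: `Ω` is open, and `Φ` maps `Ω`
diffeomorphically (in the `C^∞` sense) onto its image. -/
structure IsPointTransformation {E : Type*} [NormedAddCommGroup E] [NormedSpace ℝ E]
    (Φ : E → E) (Ω : Set E) : Prop where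
  isOpen : IsOpen Ω
  smooth : ContDiffOn ℝ ∞ Φ Ω
  injOn : InjOn Φ Ω
  bijective_fderiv : ∀ z ∈ Ω, Function.Bijective (fderiv ℝ Φ z)

/-- The total derivative `D_t F = F_t + u_t F_u` of a function of `(t, x, u)`. -/
def totT (F : Pt → ℝ) (j : Jet1) : ℝ := fderiv ℝ F j.1 (1, 0, j.2.1)

/-- The total derivative `D_x F = F_x + u_x F_u` of a function of `(t, x, u)`. -/
def totX (F : Pt → ℝ) (j : Jet1) : ℝ := fderiv ℝ F j.1 (0, 1, j.2.2)

/-- The total derivative `D_t G = G_t + u_t G_u + u_tt G_{u_t} + u_tx G_{u_x}` of a function of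
`(t, x, u, u_t, u_x)`. -/
def totT1 (G : Jet1 → ℝ) (j : Jet2) : ℝ :=
  fderiv ℝ G j.1 ((1, 0, j.1.2.1), (j.2.1, j.2.2.1))

/-- The total derivative `D_x G = G_x + u_x G_u + u_tx G_{u_t} + u_xx G_{u_x}` of a function of
`(t, x, u, u_t, u_x)`. -/
def totX1 (G : Jet1 → ℝ) (j : Jet2) : ℝ :=
  fderiv ℝ G j.1 ((0, 1, j.1.2.2), (j.2.2.1, j.2.2.2))

/-- The `t`-component of a transformation of `(t, x, u)`. -/
def compT (Φ : Pt → Pt) (z : Pt) : ℝ := (Φ z).1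

/-- The `x`-component of a transformation of `(t, x, u)`. -/
def compX (Φ : Pt → Pt) (z : Pt) : ℝ := (Φ z).2.1

/-- The `u`-component of a transformation of `(t, x, u)`. -/
def compU (Φ : Pt → Pt) (z : Pt) : ℝ := (Φ z).2.2

/-- The total Jacobian `D_t T · D_x X - D_x T · D_t X` of the `(t, x)`-components of `Φ`. The
prolongation of `Φ` is defined at the jets at which it does not vanish. -/
def totJac (Φ : Pt → Pt) (j : Jet1) : ℝ :=
  totT (compT Φ) j * totX (compX Φ) j - totX (compT Φ) j * totT (compX Φ) j

/-- The transformed derivative `ũ_t̃`. Together with `prX` it solves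
`D_t U = ũ_t̃ D_t T + ũ_x̃ D_t X`, `D_x U = ũ_t̃ D_x T + ũ_x̃ D_x X`. -/
def prT (Φ : Pt → Pt) (j : Jet1) : ℝ :=
  (totT (compU Φ) j * totX (compX Φ) j - totX (compU Φ) j * totT (compX Φ) j) / totJac Φ j

/-- The transformed derivative `ũ_x̃`. -/
def prX (Φ : Pt → Pt) (j : Jet1) : ℝ :=
  (totT (compT Φ) j * totX (compU Φ) j - totX (compT Φ) j * totT (compU Φ) j) / totJac Φ j

/-- The transformed derivative `ũ_t̃t̃`. -/
def prTT (Φ : Pt → Pt) (j : Jet2) : ℝ :=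
  (totT1 (prT Φ) j * totX (compX Φ) j.1 - totX1 (prT Φ) j * totT (compX Φ) j.1) / totJac Φ j.1

/-- The transformed derivative `ũ_t̃x̃`. -/
def prTX (Φ : Pt → Pt) (j : Jet2) : ℝ :=
  (totT1 (prX Φ) j * totX (compX Φ) j.1 - totX1 (prX Φ) j * totT (compX Φ) j.1) / totJac Φ j.1

/-- The transformed derivative `ũ_x̃x̃`. -/
def prXX (Φ : Pt → Pt) (j : Jet2) : ℝ :=
  (totT (compT Φ) j.1 * totX1 (prX Φ) j - totX (compT Φ) j.1 * totT1 (prX Φ) j) / totJac Φ j.1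

/-- The second-order prolongation of the point transformation `Φ`. -/
def prolong (Φ : Pt → Pt) (j : Jet2) : Jet2 :=
  ((Φ j.1.1, (prT Φ j.1, prX Φ j.1)), (prTT Φ j, prTX Φ j, prXX Φ j))

/-! ### Reduced Kolmogorov equations -/

/-- The equation `u_t = ε u_xx + B(t,x) u_x` as a subset of the second-order jet space. -/
def equationSet (ε : ℝ) (B : ℝ × ℝ → ℝ) : Set Jet2 :=
  {j | j.1.2.1 = ε * j.2.2.2 + B (jetTX j) * j.1.2.2}

/-- `f` is a smooth solution of `u_t = ε u_xx + B u_x` on `D`. -/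
def IsSolutionOn (ε : ℝ) (B : ℝ × ℝ → ℝ) (f : ℝ × ℝ → ℝ) (D : Set (ℝ × ℝ)) : Prop :=
  ContDiffOn ℝ ∞ f D ∧ ∀ y ∈ D,
    fderiv ℝ f y (1, 0) =
      ε * fderiv ℝ (fun y' => fderiv ℝ f y' (0, 1)) y (0, 1) + B y * fderiv ℝ f y (0, 1)

/-- `Φ` (with domain `Ω`) maps the equation with drift `B` to the one with drift `B'`:
the pullback of the target equation by the prolongation of `Φ` vanishes on the source equation. -/
def Connects (ε : ℝ) (Ω : Set Pt) (B : ℝ × ℝ → ℝ) (Φ : Pt → Pt) (B' : ℝ × ℝ → ℝ) : Prop :=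
  ∀ j : Jet2, j.1.1 ∈ Ω → totJac Φ j.1 ≠ 0 → j ∈ equationSet ε B →
    prolong Φ j ∈ equationSet ε B'

/-- `(B, Φ, B')` is an admissible transformation of the class of reduced Kolmogorov equations,
where `Ω` is the domain of `Φ`. -/
structure IsAdmissible (ε : ℝ) (Ω : Set Pt) (B : ℝ × ℝ → ℝ) (Φ : Pt → Pt)
    (B' : ℝ × ℝ → ℝ) : Prop where
  pointTransformation : IsPointTransformation Φ Ω
  smooth_source : ContDiffOn ℝ ∞ B (tx '' Ω)
  smooth_target : ContDiffOn ℝ ∞ B' (tx '' (Φ '' Ω))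
  connects : Connects ε Ω B Φ B'

/-- Open sets of `(t, x, u)`-space whose `t`-projection is an interval, and for which the set of
`x` over a fixed `t` and the set of `u` over a fixed `(t, x)` are intervals. -/
structure IsFibredDomain (Ω : Set Pt) : Prop where
  isOpen : IsOpen Ω
  preconnected_t : IsPreconnected (Prod.fst '' Ω)
  preconnected_x : ∀ t : ℝ, IsPreconnected {x : ℝ | ∃ u, (t, x, u) ∈ Ω}
  preconnected_u : ∀ t x : ℝ, IsPreconnected {u : ℝ | (t, x, u) ∈ Ω}

/-- Parameters of the `(t, x)`-components: smooth functions `T`, `X¹`, `X⁰` of `t ∈ I` with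
`X¹ ≠ 0` and `T_t = (X¹)²`. -/
structure IsBaseParam (I : Set ℝ) (T X₁ X₀ : ℝ → ℝ) : Prop where
  smooth_T : ContDiffOn ℝ ∞ T I
  smooth_X₁ : ContDiffOn ℝ ∞ X₁ I
  smooth_X₀ : ContDiffOn ℝ ∞ X₀ I
  X₁_ne_zero : ∀ t ∈ I, X₁ t ≠ 0
  deriv_T : ∀ t ∈ I, deriv T t = X₁ t ^ 2

/-- Parameters of the `u`-component: smooth functions `U¹`, `U⁰` of `(t, x) ∈ D` with `U¹ ≠ 0`
such that `1/U¹` and `U⁰/U¹` solve the equation with drift `B`. -/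
structure IsFibreParam (ε : ℝ) (B : ℝ × ℝ → ℝ) (D : Set (ℝ × ℝ)) (U₁ U₀ : ℝ × ℝ → ℝ) : Prop where
  smooth_U₁ : ContDiffOn ℝ ∞ U₁ D
  smooth_U₀ : ContDiffOn ℝ ∞ U₀ D
  U₁_ne_zero : ∀ y ∈ D, U₁ y ≠ 0
  solution_inv : IsSolutionOn ε B (fun y => 1 / U₁ y) D
  solution_div : IsSolutionOn ε B (fun y => U₀ y / U₁ y) D

/-- The transformation `t̃ = T(t)`, `x̃ = X¹(t) x + X⁰(t)`, `ũ = U¹(t,x) u + U⁰(t,x)`. -/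
def affineMap (T X₁ X₀ : ℝ → ℝ) (U₁ U₀ : ℝ × ℝ → ℝ) (z : Pt) : Pt :=
  (T z.1, X₁ z.1 * z.2.1 + X₀ z.1, U₁ (tx z) * z.2.2 + U₀ (tx z))

/-! ### Equivalence transformations -/

/-- The `(t, x, u)`-coordinates of a point of the extended jet space. -/
def extPt (e : ExtJet) : Pt := e.1.1.1

/-- The Cartan (contact) distribution on the second-order jet space: the common kernel at `j` of
`du - u_t dt - u_x dx`, `du_t - u_tt dt - u_tx dx` and `du_x - u_tx dt - u_xx dx`. -/
def cartan (j : Jet2) : Set Jet2 :=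
  {v | v.1.1.2.2 = j.1.2.1 * v.1.1.1 + j.1.2.2 * v.1.1.2.1 ∧
    v.1.2.1 = j.2.1 * v.1.1.1 + j.2.2.1 * v.1.1.2.1 ∧
    v.1.2.2 = j.2.2.1 * v.1.1.1 + j.2.2.2 * v.1.1.2.1}

/-- A point transformation of the space of `(t, x, u_(2), B)` with domain `W` that is projectable
to the spaces of `(t, x, u)` and of `(t, x, u_(2))` and consistent with the contact structure. -/
structure IsContactTransformation (𝒯 : ExtJet → ExtJet) (W : Set ExtJet) : Prop where
  pointTransformation : IsPointTransformation 𝒯 W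
  projectable_pt : ∃ Φ : Pt → Pt, ∀ e ∈ W, extPt (𝒯 e) = Φ (extPt e)
  projectable_jet : ∃ Ψ : Jet2 → Jet2, ∀ e ∈ W, (𝒯 e).1 = Ψ e.1
  contact : ∀ e ∈ W, ∀ v : ExtJet, v.1 ∈ cartan e.1 → (fderiv ℝ 𝒯 e v).1 ∈ cartan (𝒯 e).1

/-- The jets `j` over `D` at which `𝒯` can be applied to the function `θ`. -/
def jetsOf (W : Set ExtJet) (D : Set (ℝ × ℝ)) (θ : ℝ × ℝ → ℝ) : Set Jet2 :=
  {j | jetTX j ∈ D ∧ (j, θ (jetTX j)) ∈ W}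

/-- `𝒯` leaves every equation of the class in the class: every drift `θ` (smooth on an open set
`D`) is mapped to a smooth function `θ'` of `(t̃, x̃)` alone, and the equation with drift `θ` is
mapped to the one with drift `θ'`. -/
def PreservesClass (ε : ℝ) (W : Set ExtJet) (𝒯 : ExtJet → ExtJet) : Prop :=
  ∀ (D : Set (ℝ × ℝ)) (θ : ℝ × ℝ → ℝ), IsOpen D → ContDiffOn ℝ ∞ θ D →
    ∃ θ' : ℝ × ℝ → ℝ,
      ContDiffOn ℝ ∞ θ' ((fun j => jetTX (𝒯 (j, θ (jetTX j))).1) '' jetsOf W D θ) ∧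
      ∀ j ∈ jetsOf W D θ,
        (𝒯 (j, θ (jetTX j))).2 = θ' (jetTX (𝒯 (j, θ (jetTX j))).1) ∧
        (j ∈ equationSet ε θ → (𝒯 (j, θ (jetTX j))).1 ∈ equationSet ε θ')

/-- `𝒯` (with domain `W`) belongs to the usual equivalence group of the class of reduced
Kolmogorov equations. -/
structure IsEquivalenceTransformation (ε : ℝ) (W : Set ExtJet) (𝒯 : ExtJet → ExtJet) : Prop where
  contactTransformation : IsContactTransformation 𝒯 W
  preservesClass : PreservesClass ε W 𝒯

/-- Domains of transformations of the extended jet space: open sets `W` that project to a fibred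
domain of `(t, x, u)`-space and in which every occurring `(t, x, u)` and value `b` of the
arbitrary element occur at some jet satisfying `u_t = ε u_xx + b u_x`. -/
structure IsExtDomain (ε : ℝ) (W : Set ExtJet) : Prop where
  isOpen : IsOpen W
  fibred : IsFibredDomain (extPt '' W)
  meets : ∀ e ∈ W, ∃ j : Jet2, j.1.1 = extPt e ∧ (j, e.2) ∈ W ∧
    j.1.2.1 = ε * j.2.2.2 + e.2 * j.1.2.2

/-- On `W`, the `(t, x, u, B)`-components of `𝒯` are `T(t)`, `X¹ x + X⁰`, `c₁ u + c₂` and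
`B / X¹ - (X¹_t x + X⁰_t) / (X¹)²`. -/
def HasEquivalenceForm (W : Set ExtJet) (𝒯 : ExtJet → ExtJet) (T X₁ X₀ : ℝ → ℝ)
    (c₁ c₂ : ℝ) : Prop :=
  ∀ e ∈ W,
    extPt (𝒯 e) = affineMap T X₁ X₀ (fun _ => c₁) (fun _ => c₂) (extPt e) ∧
    (𝒯 e).2 = 1 / X₁ (extPt e).1 * e.2 -
      (deriv X₁ (extPt e).1 * (extPt e).2.1 + deriv X₀ (extPt e).1) / X₁ (extPt e).1 ^ 2

end Kolmogorov

end

namespace Kolmogorov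

/-! ### Partial and total derivatives -/

/-! Since `ε² = 1`, the source equation can be solved for `u_xx = ε (u_t - b u_x)`. Over a fixed
point the coordinates `u_t, u_x, u_tt, u_tx` then remain free, and the target equation must hold
identically on an open set of them. `ConnectsNear` records this condition with the two drift values
`b`, `β` at one point in place of drift functions, so that it serves both parts of the theorem.

Comparing coefficients determines the transformation. Independence of `u_tt` gives `T_x = T_u = 0`
(`ConnectsNear.pd_compT`). The coefficient of `u_t` gives `X_u = 0` and `T_t = X_x²`
(`ConnectsNear.pd_compX`). What is left is quadratic in `u_x`, and its coefficients give `U_uu = 0`,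
the relation between the drifts and an equation for `U` (`ConnectsNear.pd_compU`). Integration along
the interval fibres of the domain turns this into the affine form (`exists_affine_form`).

The equation for `U` is affine in `u` and splits into two equations for `U¹` and `U⁰`, equivalent to
`1/U¹` and `U⁰/U¹` being solutions (`isFibreParam_iff`). This is natural: constants solve every
equation of the class, and `ũ = c` pulls back to `u = (c - U⁰)/U¹`. The computation reverses
(`prolong_equation_of_form`), and the new drift is obtained by pushing a function of `(t, x)`
forward along the base map (`IsPointTransformation.exists_pushforward`).

For the equivalence group, the contact condition forces the relevant components of `𝒯` to be those
of the prolongation of its projection `Φ` (`contact_first_order`, `contact_prXX`). Constant drifts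
then give `ConnectsNear` at every point. As `Φ` does not depend on `b` while `b` varies, `U¹` and
`U⁰` have vanishing `x`-derivatives, hence vanishing `t`-derivatives, and are constant. Conversely,
`equivalenceMap` is an explicit lift of each admitted choice of parameters. -/

/-- The partial derivative of a function of `(t, x, u)` with respect to `t`. -/
noncomputable def pdT (F : Pt → ℝ) (z : Pt) : ℝ := fderiv ℝ F z (1, 0, 0)

/-- The partial derivative of a function of `(t, x, u)` with respect to `x`. -/
noncomputable def pdX (F : Pt → ℝ) (z : Pt) : ℝ := fderiv ℝ F z (0, 1, 0)

/-- The partial derivative of a function of `(t, x, u)` with respect to `u`. -/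
noncomputable def pdU (F : Pt → ℝ) (z : Pt) : ℝ := fderiv ℝ F z (0, 0, 1)

theorem fderiv_pt_apply (F : Pt → ℝ) (z : Pt) (a b c : ℝ) :
    fderiv ℝ F z (a, b, c) = a * pdT F z + b * pdX F z + c * pdU F z := by
  have h : ((a, b, c) : Pt) = a • (1, 0, 0) + b • (0, 1, 0) + c • (0, 0, 1) := by simp
  rw [h, map_add, map_add, map_smul, map_smul, map_smul]
  rfl

theorem totT_eq (F : Pt → ℝ) (j : Jet1) : totT F j = pdT F j.1 + j.2.1 * pdU F j.1 := by
  simp [totT, fderiv_pt_apply]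

theorem totX_eq (F : Pt → ℝ) (j : Jet1) : totX F j = pdX F j.1 + j.2.2 * pdU F j.1 := by
  simp [totX, fderiv_pt_apply]

theorem contDiffAt_fderiv_apply {E F : Type*} [NormedAddCommGroup E] [NormedSpace ℝ E]
    [NormedAddCommGroup F] [NormedSpace ℝ F] {f : E → F} {x : E} (hf : ContDiffAt ℝ ∞ f x)
    (v : E) : ContDiffAt ℝ ∞ (fun y => fderiv ℝ f y v) x :=
  (hf.fderiv_right (m := ∞) (by simp)).clm_apply contDiffAt_const

theorem contDiffAt_pdT {F : Pt → ℝ} {z : Pt} (hF : ContDiffAt ℝ ∞ F z) :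
    ContDiffAt ℝ ∞ (pdT F) z := contDiffAt_fderiv_apply hF _

theorem contDiffAt_pdX {F : Pt → ℝ} {z : Pt} (hF : ContDiffAt ℝ ∞ F z) :
    ContDiffAt ℝ ∞ (pdX F) z := contDiffAt_fderiv_apply hF _

theorem contDiffAt_pdU {F : Pt → ℝ} {z : Pt} (hF : ContDiffAt ℝ ∞ F z) :
    ContDiffAt ℝ ∞ (pdU F) z := contDiffAt_fderiv_apply hF _

theorem contDiffAt_totT {F : Pt → ℝ} {j : Jet1} (hF : ContDiffAt ℝ ∞ F j.1) :
    ContDiffAt ℝ ∞ (totT F) j := by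
  rw [show totT F = fun j => pdT F j.1 + j.2.1 * pdU F j.1 from funext (totT_eq F)]
  exact ((contDiffAt_pdT hF).comp j contDiffAt_fst).add
    (ContDiffAt.mul (by fun_prop) ((contDiffAt_pdU hF).comp j contDiffAt_fst))

theorem contDiffAt_totX {F : Pt → ℝ} {j : Jet1} (hF : ContDiffAt ℝ ∞ F j.1) :
    ContDiffAt ℝ ∞ (totX F) j := by
  rw [show totX F = fun j => pdX F j.1 + j.2.2 * pdU F j.1 from funext (totX_eq F)]
  exact ((contDiffAt_pdX hF).comp j contDiffAt_fst).add
    (ContDiffAt.mul (by fun_prop) ((contDiffAt_pdU hF).comp j contDiffAt_fst))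

theorem contDiffAt_compT {Φ : Pt → Pt} {z : Pt} (h : ContDiffAt ℝ ∞ Φ z) :
    ContDiffAt ℝ ∞ (compT Φ) z := h.fst

theorem contDiffAt_compX {Φ : Pt → Pt} {z : Pt} (h : ContDiffAt ℝ ∞ Φ z) :
    ContDiffAt ℝ ∞ (compX Φ) z := h.snd.fst

theorem contDiffAt_compU {Φ : Pt → Pt} {z : Pt} (h : ContDiffAt ℝ ∞ Φ z) :
    ContDiffAt ℝ ∞ (compU Φ) z := h.snd.snd

theorem contDiffAt_totJac {Φ : Pt → Pt} {j : Jet1} (h : ContDiffAt ℝ ∞ Φ j.1) :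
    ContDiffAt ℝ ∞ (totJac Φ) j :=
  ((contDiffAt_totT (contDiffAt_compT h)).mul (contDiffAt_totX (contDiffAt_compX h))).sub
    ((contDiffAt_totX (contDiffAt_compT h)).mul (contDiffAt_totT (contDiffAt_compX h)))

theorem contDiffAt_prX {Φ : Pt → Pt} {j : Jet1} (h : ContDiffAt ℝ ∞ Φ j.1)
    (hJ : totJac Φ j ≠ 0) : ContDiffAt ℝ ∞ (prX Φ) j :=
  (((contDiffAt_totT (contDiffAt_compT h)).mul (contDiffAt_totX (contDiffAt_compU h))).sub
    ((contDiffAt_totX (contDiffAt_compT h)).mul (contDiffAt_totT (contDiffAt_compU h)))).div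
    (contDiffAt_totJac h) hJ

/-- The derivative of a transformation of `(t, x, u)`, by components. -/
theorem fderiv_apply_eq_comp {Φ : Pt → Pt} {z : Pt} (h : DifferentiableAt ℝ Φ z) (v : Pt) :
    fderiv ℝ Φ z v =
      (fderiv ℝ (compT Φ) z v, fderiv ℝ (compX Φ) z v, fderiv ℝ (compU Φ) z v) := by
  have h1 : HasFDerivAt (compT Φ) _ z := h.hasFDerivAt.fst
  have h2 : HasFDerivAt (compX Φ) _ z := h.hasFDerivAt.snd.fst
  have h3 : HasFDerivAt (compU Φ) _ z := h.hasFDerivAt.snd.snd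
  rw [h1.fderiv, h2.fderiv, h3.fderiv]
  rfl

/-- The Jacobian determinant of a transformation of `(t, x, u)`. -/
noncomputable def jacDet (Φ : Pt → Pt) (z : Pt) : ℝ :=
  pdT (compT Φ) z * (pdX (compX Φ) z * pdU (compU Φ) z - pdU (compX Φ) z * pdX (compU Φ) z) -
  pdX (compT Φ) z * (pdT (compX Φ) z * pdU (compU Φ) z - pdU (compX Φ) z * pdT (compU Φ) z) +
  pdU (compT Φ) z * (pdT (compX Φ) z * pdX (compU Φ) z - pdX (compX Φ) z * pdT (compU Φ) z)

/-- Preimages of the three basis vectors are the columns of a right inverse of the Jacobian matrix,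
so its determinant is a unit. -/
theorem jacDet_ne_zero {Φ : Pt → Pt} {z : Pt} (h : DifferentiableAt ℝ Φ z)
    (hb : Function.Bijective (fderiv ℝ Φ z)) : jacDet Φ z ≠ 0 := by
  obtain ⟨⟨a1, a2, a3⟩, ha⟩ := hb.2 (1, 0, 0)
  obtain ⟨⟨b1, b2, b3⟩, hb'⟩ := hb.2 (0, 1, 0)
  obtain ⟨⟨c1, c2, c3⟩, hc⟩ := hb.2 (0, 0, 1)
  rw [fderiv_apply_eq_comp h] at ha hb' hc
  simp only [fderiv_pt_apply, Prod.mk.injEq] at ha hb' hc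
  set M : Matrix (Fin 3) (Fin 3) ℝ :=
    !![pdT (compT Φ) z, pdX (compT Φ) z, pdU (compT Φ) z;
       pdT (compX Φ) z, pdX (compX Φ) z, pdU (compX Φ) z;
       pdT (compU Φ) z, pdX (compU Φ) z, pdU (compU Φ) z] with hM
  have hMN : M * !![a1, b1, c1; a2, b2, c2; a3, b3, c3] = 1 := by
    ext i k
    fin_cases i <;> fin_cases k <;>
      simp [hM, Matrix.mul_apply, Fin.sum_univ_three] <;> linarith
  have hdet := congrArg Matrix.det hMN
  rw [Matrix.det_mul, Matrix.det_one] at hdet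
  have : M.det = jacDet Φ z := by
    rw [Matrix.det_fin_three, jacDet]; simp [hM]; ring
  rw [← this]
  intro h0
  rw [h0, zero_mul] at hdet
  exact zero_ne_one hdet

/-- The derivative of a function along a line through a point. -/
theorem fderiv_eq_of_hasDerivAt_line {E : Type*} [NormedAddCommGroup E] [NormedSpace ℝ E]
    {f : E → ℝ} {x v : E} {d : ℝ} (hf : DifferentiableAt ℝ f x)
    (h : HasDerivAt (fun c : ℝ => f (x + c • v)) d 0) : fderiv ℝ f x v = d := by
  have hl : HasDerivAt (fun c : ℝ => x + c • v) v 0 := by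
    simpa using ((hasDerivAt_id (0 : ℝ)).smul_const v).const_add x
  have h2 := HasFDerivAt.comp_hasDerivAt (x := (0 : ℝ)) (f := fun c : ℝ => x + c • v)
    (l := f) (l' := fderiv ℝ f x) (by simpa using hf.hasFDerivAt) hl
  exact h2.unique h

theorem fderiv_div_apply {E : Type*} [NormedAddCommGroup E] [NormedSpace ℝ E]
    {f g : E → ℝ} {x : E} (hf : DifferentiableAt ℝ f x) (hg : DifferentiableAt ℝ g x)
    (h0 : g x ≠ 0) (v : E) :
    fderiv ℝ (fun y => f y / g y) x v =
      (fderiv ℝ f x v * g x - f x * fderiv ℝ g x v) / g x ^ 2 := by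
  have h := hf.hasFDerivAt.fun_mul ((hasDerivAt_inv h0).comp_hasFDerivAt x hg.hasFDerivAt)
  have h' : (fun y => f y / g y) = fun y => f y * ((fun y => y⁻¹) ∘ g) y := by
    funext y
    simp [div_eq_mul_inv]
  rw [h', h.fderiv]
  simp
  field_simp
  ring

/-- The derivative of `ũ_x̃` with respect to `(u_t, u_x)`. -/
theorem fderiv_prX_vertical {Φ : Pt → Pt} {z : Pt} {p q : ℝ} (h : ContDiffAt ℝ ∞ Φ z)
    (hJ : totJac Φ (z, (p, q)) ≠ 0) (r s : ℝ) :
    fderiv ℝ (prX Φ) (z, (p, q)) (0, (r, s)) =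
      (s * totT (compT Φ) (z, (p, q)) - r * totX (compT Φ) (z, (p, q))) * jacDet Φ z /
        totJac Φ (z, (p, q)) ^ 2 := by
  refine fderiv_eq_of_hasDerivAt_line
    ((contDiffAt_prX h hJ).differentiableAt (by simp)) ?_
  have hp : ∀ A C : ℝ, HasDerivAt (fun c : ℝ => A + (p + c * r) * C) (r * C) 0 := by
    intro A C
    simpa using ((((hasDerivAt_id (0 : ℝ)).mul_const r).const_add p).mul_const C).const_add A
  have hq : ∀ A C : ℝ, HasDerivAt (fun c : ℝ => A + (q + c * s) * C) (s * C) 0 := by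
    intro A C
    simpa using ((((hasDerivAt_id (0 : ℝ)).mul_const s).const_add q).mul_const C).const_add A
  simp only [totJac, totT_eq, totX_eq] at hJ
  have key := (((hp (pdT (compT Φ) z) (pdU (compT Φ) z)).mul
    (hq (pdX (compU Φ) z) (pdU (compU Φ) z))).sub ((hq (pdX (compT Φ) z) (pdU (compT Φ) z)).mul
    (hp (pdT (compU Φ) z) (pdU (compU Φ) z)))).div
    (((hp (pdT (compT Φ) z) (pdU (compT Φ) z)).mul
    (hq (pdX (compX Φ) z) (pdU (compX Φ) z))).sub ((hq (pdX (compT Φ) z) (pdU (compT Φ) z)).mul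
    (hp (pdT (compX Φ) z) (pdU (compX Φ) z)))) (by simpa using hJ)
  simp only [prX, totJac, totT_eq, totX_eq]
  refine HasDerivAt.congr_of_eventuallyEq (key.congr_deriv ?_) (Filter.Eventually.of_forall
    fun c => ?_)
  -- The numerator from the quotient rule factors through the full Jacobian determinant; this is
  -- what makes the second-order part of `ũ_x̃x̃` nondegenerate.
  · simp only [zero_mul, add_zero, jacDet, Pi.sub_apply, Pi.mul_apply]
    field_simp
    ring
  · simp

/-! ### The equation for transformed jets over a fixed point -/

/-- The dependence of `ũ_x̃x̃` on the second-order derivatives. -/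
theorem prXX_eq_affine {Φ : Pt → Pt} {z : Pt} {p q : ℝ} (h : ContDiffAt ℝ ∞ Φ z)
    (hJ : totJac Φ (z, (p, q)) ≠ 0) (m n s : ℝ) :
    prXX Φ ((z, (p, q)), (m, n, s)) =
      (totT (compT Φ) (z, (p, q)) * fderiv ℝ (prX Φ) (z, (p, q)) ((0, 1, q), (0, 0)) -
        totX (compT Φ) (z, (p, q)) * fderiv ℝ (prX Φ) (z, (p, q)) ((1, 0, p), (0, 0))) /
          totJac Φ (z, (p, q)) +
      (s * totT (compT Φ) (z, (p, q)) ^ 2 -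
        2 * n * totT (compT Φ) (z, (p, q)) * totX (compT Φ) (z, (p, q)) +
        m * totX (compT Φ) (z, (p, q)) ^ 2) * jacDet Φ z / totJac Φ (z, (p, q)) ^ 3 := by
  -- The second-order coordinates occur only in the vertical part of a total derivative, where
  -- `fderiv_prX_vertical` applies.
  have split : ∀ (w : Pt) (r r' : ℝ), ((w, (r, r')) : Jet1) = (w, (0, 0)) + (0, (r, r')) := by
    intro w r r'; simp
  simp only [prXX, totX1, totT1]
  rw [split _ n s, split _ m n, map_add, map_add, fderiv_prX_vertical h hJ,
    fderiv_prX_vertical h hJ]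
  field_simp
  ring

/-- The prolongation of `Φ` maps the jets over `z` with `u_t = ε u_xx + b u_x`, in some nonempty
open set of such jets, to jets with `ũ_t̃ = ε ũ_x̃x̃ + β ũ_x̃`. -/
def ConnectsNear (ε b β : ℝ) (Φ : Pt → Pt) (z : Pt) : Prop :=
  ∃ p₀ q₀ m₀ n₀ r : ℝ, 0 < r ∧ ∀ p q m n : ℝ,
    |p - p₀| < r → |q - q₀| < r → |m - m₀| < r → |n - n₀| < r →
      totJac Φ (z, (p, q)) ≠ 0 ∧
      prT Φ (z, (p, q)) =
        ε * prXX Φ ((z, (p, q)), (m, n, ε * (p - b * q))) + β * prX Φ (z, (p, q))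

/-- Changing `u_tt` alone affects only `ũ_x̃x̃`, where its coefficient is `(D_x T)²` times a nonzero
factor. Hence `D_x T = T_x + u_x T_u` vanishes for an interval of `u_x`. -/
theorem ConnectsNear.pd_compT {ε b β : ℝ} {Φ : Pt → Pt} {z : Pt} (hε : ε ^ 2 = 1)
    (hΦ : ContDiffAt ℝ ∞ Φ z) (hdet : jacDet Φ z ≠ 0) (h : ConnectsNear ε b β Φ z) :
    pdX (compT Φ) z = 0 ∧ pdU (compT Φ) z = 0 := by
  obtain ⟨p₀, q₀, m₀, n₀, r, hr, hc⟩ := h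
  have hε0 : ε ≠ 0 := by rintro rfl; norm_num at hε
  have key : ∀ q, |q - q₀| < r → totX (compT Φ) (z, (p₀, q)) = 0 := by
    intro q hq
    obtain ⟨hJ, e1⟩ := hc p₀ q m₀ n₀ (by simpa) hq (by simpa) (by simpa)
    obtain ⟨-, e2⟩ := hc p₀ q (m₀ + r / 2) n₀ (by simpa) hq
      (by rw [add_sub_cancel_left, abs_of_pos (by linarith)]; linarith) (by simpa)
    rw [e1, prXX_eq_affine hΦ hJ, prXX_eq_affine hΦ hJ] at e2
    have e3 : ε * (r / 2) * jacDet Φ z * totX (compT Φ) (z, (p₀, q)) ^ 2 /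
        totJac Φ (z, (p₀, q)) ^ 3 = 0 := by
      linear_combination -e2
    have hJ3 := pow_ne_zero 3 hJ
    rw [div_eq_zero_iff, or_iff_left hJ3] at e3
    have hc0 : ε * (r / 2) * jacDet Φ z ≠ 0 := by positivity
    exact pow_eq_zero_iff (two_ne_zero) |>.1 ((mul_eq_zero.1 e3).resolve_left hc0)
  have k1 := key q₀ (by simpa)
  have k2 := key (q₀ + r / 2) (by rw [add_sub_cancel_left, abs_of_pos (by linarith)]; linarith)
  rw [totX_eq] at k1 k2
  simp only at k1 k2
  have hu : r / 2 * pdU (compT Φ) z = 0 := by linear_combination k2 - k1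
  have hu0 : pdU (compT Φ) z = 0 := (mul_eq_zero.1 hu).resolve_left (by positivity)
  refine ⟨by simpa [hu0] using k1, hu0⟩

/-! ### Prolongation of transformations whose `t`-component depends on `t` only -/

/-- The part of `D_x D_x F` that does not involve `u_xx`, at a jet with `u_x = q`. -/
noncomputable def totXX (F : Pt → ℝ) (z : Pt) (q : ℝ) : ℝ :=
  pdX (pdX F) z + q * (pdU (pdX F) z + pdX (pdU F) z) + q ^ 2 * pdU (pdU F) z

theorem fderiv_totX {F : Pt → ℝ} {z : Pt} (hF : ContDiffAt ℝ ∞ F z) (p q n s : ℝ) :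
    fderiv ℝ (totX F) (z, (p, q)) ((0, 1, q), (n, s)) = totXX F z q + s * pdU F z := by
  rw [show totX F = fun j => pdX F j.1 + j.2.2 * pdU F j.1 from funext (totX_eq F)]
  have h1 : HasFDerivAt (fun j : Jet1 => pdX F j.1) _ (z, (p, q)) :=
    HasFDerivAt.comp (z, (p, q)) (g := pdX F) (f := Prod.fst)
      ((contDiffAt_pdX hF).differentiableAt (by simp)).hasFDerivAt hasFDerivAt_fst
  have h2 : HasFDerivAt (fun j : Jet1 => pdU F j.1) _ (z, (p, q)) :=
    HasFDerivAt.comp (z, (p, q)) (g := pdU F) (f := Prod.fst)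
      ((contDiffAt_pdU hF).differentiableAt (by simp)).hasFDerivAt hasFDerivAt_fst
  have h3 : HasFDerivAt (fun j : Jet1 => j.2.2) _ (z, (p, q)) :=
    (hasFDerivAt_id (𝕜 := ℝ) ((z, (p, q)) : Jet1)).snd.snd
  rw [(h1.fun_add (h3.fun_mul h2)).fderiv]
  simp [fderiv_pt_apply, totXX]
  ring

theorem totJac_eq_of_pd_compT {Φ : Pt → Pt} {j : Jet1} (hx : pdX (compT Φ) j.1 = 0)
    (hu : pdU (compT Φ) j.1 = 0) : totJac Φ j = pdT (compT Φ) j.1 * totX (compX Φ) j := by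
  simp [totJac, totT_eq, totX_eq, hx, hu]

theorem prX_eq_of_pd_compT {Φ : Pt → Pt} {j : Jet1} (hx : pdX (compT Φ) j.1 = 0)
    (hu : pdU (compT Φ) j.1 = 0) (hJ : totJac Φ j ≠ 0) :
    prX Φ j = totX (compU Φ) j / totX (compX Φ) j := by
  rw [prX, totT_eq (compT Φ), totX_eq (compT Φ), hx, hu]
  rw [totJac_eq_of_pd_compT hx hu] at hJ ⊢
  have h1 := left_ne_zero_of_mul hJ
  have h2 := right_ne_zero_of_mul hJ
  field_simp
  ring

theorem prT_eq_of_pd_compT {Φ : Pt → Pt} {j : Jet1} (hx : pdX (compT Φ) j.1 = 0)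
    (hu : pdU (compT Φ) j.1 = 0) :
    prT Φ j = (totT (compU Φ) j * totX (compX Φ) j - totX (compU Φ) j * totT (compX Φ) j) /
      (pdT (compT Φ) j.1 * totX (compX Φ) j) := by
  rw [prT, totJac_eq_of_pd_compT hx hu]

theorem prXX_eq_of_pd_compT {Φ : Pt → Pt} {z : Pt} (hΦ : ContDiffAt ℝ ∞ Φ z)
    (hT : ∀ᶠ z' in nhds z, pdX (compT Φ) z' = 0 ∧ pdU (compT Φ) z' = 0) {p q : ℝ}
    (hJ : totJac Φ (z, (p, q)) ≠ 0) (m n s : ℝ) :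
    prXX Φ ((z, (p, q)), (m, n, s)) =
      ((totXX (compU Φ) z q + s * pdU (compU Φ) z) * totX (compX Φ) (z, (p, q)) -
        totX (compU Φ) (z, (p, q)) * (totXX (compX Φ) z q + s * pdU (compX Φ) z)) /
          totX (compX Φ) (z, (p, q)) ^ 3 := by
  have hT0 := hT.self_of_nhds
  -- Equality on a neighbourhood is needed because `ũ_x̃` is about to be differentiated.
  have hev : prX Φ =ᶠ[nhds (z, (p, q))] fun j => totX (compU Φ) j / totX (compX Φ) j := by
    have hJ' : ∀ᶠ j in nhds (z, (p, q)), totJac Φ j ≠ 0 :=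
      (contDiffAt_totJac (j := (z, (p, q))) hΦ).continuousAt.eventually_ne hJ
    have hT' : ∀ᶠ j : Jet1 in nhds (z, (p, q)),
        pdX (compT Φ) j.1 = 0 ∧ pdU (compT Φ) j.1 = 0 :=
      (continuous_fst.tendsto (z, (p, q)) : Filter.Tendsto Prod.fst _ _).eventually hT
    filter_upwards [hJ', hT'] with j h1 h2
    exact prX_eq_of_pd_compT h2.1 h2.2 h1
  have hJ2 := hJ
  rw [totJac_eq_of_pd_compT (by exact hT0.1) (by exact hT0.2)] at hJ2
  have h1 := left_ne_zero_of_mul hJ2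
  have h2 := right_ne_zero_of_mul hJ2
  have hU := (contDiffAt_totX (j := (z, (p, q))) (contDiffAt_compU hΦ)).differentiableAt
    (by simp)
  have hX := (contDiffAt_totX (j := (z, (p, q))) (contDiffAt_compX hΦ)).differentiableAt
    (by simp)
  have hXs := fderiv_totX (contDiffAt_compX hΦ) p q n s
  have hUs := fderiv_totX (contDiffAt_compU hΦ) p q n s
  have hdiv : totX1 (prX Φ) ((z, (p, q)), (m, n, s)) =
      ((totXX (compU Φ) z q + s * pdU (compU Φ) z) * totX (compX Φ) (z, (p, q)) -
        totX (compU Φ) (z, (p, q)) * (totXX (compX Φ) z q + s * pdU (compX Φ) z)) /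
          totX (compX Φ) (z, (p, q)) ^ 2 := by
    rw [totX1, hev.fderiv_eq, fderiv_div_apply hU hX h2]
    simp only [hXs, hUs]
  rw [prXX, hdiv, totJac_eq_of_pd_compT (by exact hT0.1) (by exact hT0.2),
    totT_eq (compT Φ), totX_eq (compT Φ)]
  simp only [hT0.1, hT0.2]
  field_simp
  ring

/-- With `u_xx` eliminated, equating the coefficients of `u_t` gives `T_t = (D_x X)²`. The right
side is a polynomial in `u_x` and must be constant. -/
theorem ConnectsNear.pd_compX {ε b β : ℝ} {Φ : Pt → Pt} {z : Pt} (hε : ε ^ 2 = 1)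
    (hΦ : ContDiffAt ℝ ∞ Φ z) (hdet : jacDet Φ z ≠ 0)
    (hT : ∀ᶠ z' in nhds z, pdX (compT Φ) z' = 0 ∧ pdU (compT Φ) z' = 0)
    (h : ConnectsNear ε b β Φ z) :
    pdU (compX Φ) z = 0 ∧ pdT (compT Φ) z = pdX (compX Φ) z ^ 2 := by
  obtain ⟨p₀, q₀, m₀, n₀, r, hr, hc⟩ := h
  have hT0 := hT.self_of_nhds
  have hdet' := hdet
  rw [jacDet, hT0.1, hT0.2] at hdet'
  have key : ∀ q, |q - q₀| < r →
      pdT (compT Φ) z = (pdX (compX Φ) z + q * pdU (compX Φ) z) ^ 2 := by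
    intro q hq
    obtain ⟨hJ1, e1⟩ := hc p₀ q m₀ n₀ (by simpa) hq (by simpa) (by simpa)
    obtain ⟨hJ2, e2⟩ := hc (p₀ + r / 2) q m₀ n₀
      (by rw [add_sub_cancel_left, abs_of_pos (by linarith)]; linarith) hq (by simpa) (by simpa)
    rw [prXX_eq_of_pd_compT hΦ hT hJ1, prT_eq_of_pd_compT hT0.1 hT0.2,
      prX_eq_of_pd_compT hT0.1 hT0.2 hJ1] at e1
    rw [prXX_eq_of_pd_compT hΦ hT hJ2, prT_eq_of_pd_compT hT0.1 hT0.2,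
      prX_eq_of_pd_compT hT0.1 hT0.2 hJ2] at e2
    rw [totJac_eq_of_pd_compT hT0.1 hT0.2] at hJ1
    have h1 := left_ne_zero_of_mul hJ1
    have h2 := right_ne_zero_of_mul hJ1
    simp only [totX_eq, totT_eq] at e1 e2 h1 h2
    set D := pdX (compX Φ) z + q * pdU (compX Φ) z
    set E := pdX (compU Φ) z + q * pdU (compU Φ) z
    -- The terms in `q` cancel, so this is `X_x U_u - X_u U_x`; times `T_t` it is the Jacobian
    -- determinant.
    have hΔ : pdU (compU Φ) z * D - E * pdU (compX Φ) z ≠ 0 := by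
      intro h0
      apply hdet'
      linear_combination (pdT (compT Φ) z) * h0
    field_simp at e1 e2
    have e3 : r * (pdU (compU Φ) z * D - E * pdU (compX Φ) z) * (D ^ 2 - pdT (compT Φ) z) = 0 := by
      linear_combination e2 - 2 * e1 +
        r * (pdU (compU Φ) z * D - E * pdU (compX Φ) z) * pdT (compT Φ) z * hε
    have := (mul_eq_zero.1 e3).resolve_left (mul_ne_zero hr.ne' hΔ)
    linarith
  have k1 := key q₀ (by simpa)
  have k2 := key (q₀ + r / 2) (by rw [add_sub_cancel_left, abs_of_pos (by linarith)]; linarith)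
  have k3 := key (q₀ - r / 2) (by
    rw [sub_sub_cancel_left, abs_neg, abs_of_pos (by linarith)]; linarith)
  -- The second difference in `q` with step `r / 2` isolates the leading coefficient.
  have hu : r ^ 2 * pdU (compX Φ) z ^ 2 = 0 := by linear_combination 4 * k1 - 2 * k2 - 2 * k3
  have hu0 : pdU (compX Φ) z = 0 :=
    pow_eq_zero_iff (two_ne_zero) |>.1 ((mul_eq_zero.1 hu).resolve_left (by positivity))
  exact ⟨hu0, by simpa [hu0] using k1⟩

/-- For transformations of the form `t̃ = T(t)`, `x̃ = X¹(t) x + X⁰(t)` with `T_t = (X¹)²`, the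
transformed equation on a jet satisfying the original equation. -/
theorem prolong_equation_iff {ε : ℝ} {Φ : Pt → Pt} {z : Pt} (hε : ε ^ 2 = 1)
    (hΦ : ContDiffAt ℝ ∞ Φ z)
    (hT : ∀ᶠ z' in nhds z, pdX (compT Φ) z' = 0 ∧ pdU (compT Φ) z' = 0)
    (hTX : pdT (compT Φ) z = pdX (compX Φ) z ^ 2) (hXu : pdU (compX Φ) z = 0)
    {p q : ℝ} (hXX : totXX (compX Φ) z q = 0)
    (hJ : totJac Φ (z, (p, q)) ≠ 0) (b β m n : ℝ) :
    prT Φ (z, (p, q)) =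
        ε * prXX Φ ((z, (p, q)), (m, n, ε * (p - b * q))) + β * prX Φ (z, (p, q)) ↔
      pdT (compU Φ) z + b * q * pdU (compU Φ) z -
          (pdX (compU Φ) z + q * pdU (compU Φ) z) * pdT (compX Φ) z / pdX (compX Φ) z =
        ε * totXX (compU Φ) z q +
          β * pdX (compX Φ) z * (pdX (compU Φ) z + q * pdU (compU Φ) z) := by
  have hT0 := hT.self_of_nhds
  rw [prXX_eq_of_pd_compT hΦ hT hJ, prT_eq_of_pd_compT hT0.1 hT0.2,
    prX_eq_of_pd_compT hT0.1 hT0.2 hJ]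
  rw [totJac_eq_of_pd_compT hT0.1 hT0.2] at hJ
  have h2 := right_ne_zero_of_mul hJ
  simp only [totX_eq, totT_eq, hXu, hXX, hTX, mul_zero, add_zero, sub_zero] at h2 ⊢
  set a := pdX (compX Φ) z
  field_simp
  -- Eliminating `u_xx` produces a multiple of `ε² (p - b q) U_u`; since `ε² = 1`, the variable `p`
  -- cancels and only the term `b q U_u` survives.
  constructor
  · intro h
    linear_combination h + (p - q * b) * a * pdU (compU Φ) z * hε
  · intro h
    linear_combination h - (p - q * b) * a * pdU (compU Φ) z * hε

/-- The remaining condition is a quadratic identity in `q = u_x` on an interval. Second and first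
differences, and then the value at `q₀`, extract its three coefficients. -/
theorem ConnectsNear.pd_compU {ε b β : ℝ} {Φ : Pt → Pt} {z : Pt} (hε : ε ^ 2 = 1)
    (hΦ : ContDiffAt ℝ ∞ Φ z)
    (hT : ∀ᶠ z' in nhds z, pdX (compT Φ) z' = 0 ∧ pdU (compT Φ) z' = 0)
    (hTX : pdT (compT Φ) z = pdX (compX Φ) z ^ 2) (hXu : pdU (compX Φ) z = 0)
    (hXX : ∀ q, totXX (compX Φ) z q = 0) (h : ConnectsNear ε b β Φ z) :
    pdU (pdU (compU Φ)) z = 0 ∧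
    (b - pdT (compX Φ) z / pdX (compX Φ) z - β * pdX (compX Φ) z) * pdU (compU Φ) z =
      ε * (pdU (pdX (compU Φ)) z + pdX (pdU (compU Φ)) z) ∧
    pdT (compU Φ) z = ε * pdX (pdX (compU Φ)) z +
      (pdT (compX Φ) z / pdX (compX Φ) z + β * pdX (compX Φ) z) * pdX (compU Φ) z := by
  obtain ⟨p₀, q₀, m₀, n₀, r, hr, hc⟩ := h
  have hε0 : ε ≠ 0 := by rintro rfl; norm_num at hε
  have key : ∀ q, |q - q₀| < r →
      pdT (compU Φ) z + b * q * pdU (compU Φ) z -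
          (pdX (compU Φ) z + q * pdU (compU Φ) z) * pdT (compX Φ) z / pdX (compX Φ) z =
        ε * totXX (compU Φ) z q +
          β * pdX (compX Φ) z * (pdX (compU Φ) z + q * pdU (compU Φ) z) := by
    intro q hq
    obtain ⟨hJ1, e1⟩ := hc p₀ q m₀ n₀ (by simpa) hq (by simpa) (by simpa)
    exact (prolong_equation_iff hε hΦ hT hTX hXu (hXX q) hJ1 b β m₀ n₀).1 e1
  have k1 := key q₀ (by simpa)
  have k2 := key (q₀ + r / 2) (by rw [add_sub_cancel_left, abs_of_pos (by linarith)]; linarith)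
  have k3 := key (q₀ - r / 2) (by
    rw [sub_sub_cancel_left, abs_neg, abs_of_pos (by linarith)]; linarith)
  simp only [totXX] at k1 k2 k3
  have c2 : r ^ 2 * ε * pdU (pdU (compU Φ)) z = 0 := by
    linear_combination 4 * k1 - 2 * k2 - 2 * k3
  have c2' : pdU (pdU (compU Φ)) z = 0 := (mul_eq_zero.1 c2).resolve_left (by positivity)
  have c1 : r * ((b - pdT (compX Φ) z / pdX (compX Φ) z - β * pdX (compX Φ) z) * pdU (compU Φ) z -
      ε * (pdU (pdX (compU Φ)) z + pdX (pdU (compU Φ)) z)) = 0 := by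
    rw [c2'] at k2 k3
    linear_combination k2 - k3
  have c1' := (mul_eq_zero.1 c1).resolve_left hr.ne'
  refine ⟨c2', by linarith, ?_⟩
  rw [c2'] at k1
  linear_combination k1 - q₀ * c1'

/-! ### Functions on fibred domains -/

theorem isOpen_tx_image {Ω : Set Pt} (hΩ : IsOpen Ω) : IsOpen (tx '' Ω) := by
  have : tx '' Ω = ⋃ u : ℝ, (fun y : ℝ × ℝ => ((y.1, y.2, u) : Pt)) ⁻¹' Ω := by
    ext ⟨t, x⟩
    simp [tx]
  rw [this]
  exact isOpen_iUnion fun u => hΩ.preimage (by fun_prop)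

theorem fst_image_tx_image (Ω : Set Pt) : Prod.fst '' (tx '' Ω) = Prod.fst '' Ω := by
  rw [image_image]; rfl

theorem isOpen_fst_image {Ω : Set Pt} (hΩ : IsOpen Ω) : IsOpen (Prod.fst '' Ω) :=
  isOpenMap_fst _ hΩ

/-- A function of `(t, x, u)` that does not depend on `u` is a smooth function of `(t, x)`. -/
theorem exists_eq_comp_tx {Ω : Set Pt} (hΩ : IsFibredDomain Ω) {f : Pt → ℝ}
    (hf : ContDiffOn ℝ ∞ f Ω) (hu : ∀ z ∈ Ω, pdU f z = 0) :
    ∃ g : ℝ × ℝ → ℝ, ContDiffOn ℝ ∞ g (tx '' Ω) ∧ ∀ z ∈ Ω, f z = g (tx z) := by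
  classical
  have hconst : ∀ t x u u', (t, x, u) ∈ Ω → (t, x, u') ∈ Ω → f (t, x, u) = f (t, x, u') := by
    intro t x u u' h h'
    have hd : ∀ w ∈ {u : ℝ | (t, x, u) ∈ Ω}, HasDerivAt (fun u => f (t, x, u)) 0 w := by
      intro w hw
      have h1 := ((hf.contDiffAt (hΩ.isOpen.mem_nhds hw)).differentiableAt (by simp)).hasFDerivAt
      have h2 : HasDerivAt (fun u : ℝ => ((t, x, u) : Pt)) (0, 0, 1) w :=
        (hasDerivAt_const w t).prodMk ((hasDerivAt_const w x).prodMk (hasDerivAt_id w))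
      have h3 := h1.comp_hasDerivAt w h2
      rwa [show fderiv ℝ f (t, x, w) (0, 0, 1) = 0 from hu _ hw] at h3
    exact (hΩ.isOpen.preimage (f := fun u : ℝ => ((t, x, u) : Pt))
      (by fun_prop)).is_const_of_deriv_eq_zero (hΩ.preconnected_u t x)
      (fun w hw => (hd w hw).differentiableAt.differentiableWithinAt)
      (fun w hw => (hd w hw).deriv) h h'
  -- Any choice of `u` over `(t, x)` gives the same value. Smoothness is then checked near a point
  -- by comparison with a slice of `f` at one fixed `u`; the default `0` is never met over `Ω`.
  set g : ℝ × ℝ → ℝ := fun y =>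
    if h : ∃ u, (y.1, y.2, u) ∈ Ω then f (y.1, y.2, h.choose) else 0 with hg
  have hgf : ∀ z ∈ Ω, f z = g (tx z) := by
    rintro ⟨t, x, u⟩ hz
    have h : ∃ u, (t, x, u) ∈ Ω := ⟨u, hz⟩
    simp only [hg, tx]
    rw [dif_pos h]
    exact hconst _ _ _ _ hz h.choose_spec
  refine ⟨g, ?_, hgf⟩
  rintro _ ⟨⟨t, x, u⟩, hz, rfl⟩
  refine ContDiffAt.contDiffWithinAt ?_
  have hc : ContDiffAt ℝ ∞ (fun y : ℝ × ℝ => f (y.1, y.2, u)) (t, x) :=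
    ContDiffAt.comp (t, x) (g := f) (f := fun y : ℝ × ℝ => ((y.1, y.2, u) : Pt))
      (hf.contDiffAt (hΩ.isOpen.mem_nhds hz)) (by fun_prop)
  refine hc.congr_of_eventuallyEq ?_
  have : ∀ᶠ y : ℝ × ℝ in nhds (t, x), ((y.1, y.2, u) : Pt) ∈ Ω :=
    (hΩ.isOpen.preimage (f := fun y : ℝ × ℝ => ((y.1, y.2, u) : Pt)) (by fun_prop)).mem_nhds hz
  filter_upwards [this] with y hy
  exact (hgf _ hy).symm

/-- A function of `(t, x)` that does not depend on `x` is a smooth function of `t`. -/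
theorem exists_eq_comp_fst {Ω : Set Pt} (hΩ : IsFibredDomain Ω) {g : ℝ × ℝ → ℝ}
    (hg : ContDiffOn ℝ ∞ g (tx '' Ω)) (hx : ∀ y ∈ tx '' Ω, fderiv ℝ g y (0, 1) = 0) :
    ∃ h : ℝ → ℝ, ContDiffOn ℝ ∞ h (Prod.fst '' Ω) ∧ ∀ y ∈ tx '' Ω, g y = h y.1 := by
  classical
  have hD := isOpen_tx_image hΩ.isOpen
  have hsec : ∀ t, {x : ℝ | (t, x) ∈ tx '' Ω} = {x : ℝ | ∃ u, (t, x, u) ∈ Ω} := by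
    intro t; ext x; simp [tx]
  have hconst : ∀ t x x', (t, x) ∈ tx '' Ω → (t, x') ∈ tx '' Ω → g (t, x) = g (t, x') := by
    intro t x x' h h'
    have hd : ∀ w ∈ {x : ℝ | (t, x) ∈ tx '' Ω}, HasDerivAt (fun x => g (t, x)) 0 w := by
      intro w hw
      have h1 := ((hg.contDiffAt (hD.mem_nhds hw)).differentiableAt (by simp)).hasFDerivAt
      have h2 : HasDerivAt (fun x : ℝ => (t, x)) (0, 1) w :=
        (hasDerivAt_const w t).prodMk (hasDerivAt_id w)
      have h3 := h1.comp_hasDerivAt w h2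
      rwa [hx _ hw] at h3
    exact (hD.preimage (f := fun x : ℝ => (t, x)) (by fun_prop)).is_const_of_deriv_eq_zero
      (by have := hΩ.preconnected_x t; rwa [← hsec] at this)
      (fun w hw => (hd w hw).differentiableAt.differentiableWithinAt)
      (fun w hw => (hd w hw).deriv) h h'
  set h : ℝ → ℝ := fun t =>
    if h : ∃ x, (t, x) ∈ tx '' Ω then g (t, h.choose) else 0 with hh
  have hgf : ∀ y ∈ tx '' Ω, g y = h y.1 := by
    rintro ⟨t, x⟩ hz
    have h : ∃ x, (t, x) ∈ tx '' Ω := ⟨x, hz⟩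
    simp only [hh]
    rw [dif_pos h]
    exact hconst _ _ _ hz h.choose_spec
  refine ⟨h, ?_, hgf⟩
  rw [← fst_image_tx_image]
  rintro _ ⟨⟨t, x⟩, hz, rfl⟩
  refine ContDiffAt.contDiffWithinAt ?_
  have hc : ContDiffAt ℝ ∞ (fun s : ℝ => g (s, x)) t :=
    ContDiffAt.comp t (g := g) (f := fun s : ℝ => (s, x))
      (hg.contDiffAt (hD.mem_nhds hz)) (by fun_prop)
  refine hc.congr_of_eventuallyEq ?_
  have : ∀ᶠ s : ℝ in nhds t, (s, x) ∈ tx '' Ω :=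
    (hD.preimage (f := fun s : ℝ => (s, x)) (by fun_prop)).mem_nhds hz
  filter_upwards [this] with s hs
  exact (hgf _ hs).symm

theorem hasFDerivAt_tx (z : Pt) : HasFDerivAt tx
    ((ContinuousLinearMap.fst ℝ ℝ (ℝ × ℝ)).prod
      ((ContinuousLinearMap.fst ℝ ℝ ℝ).comp (ContinuousLinearMap.snd ℝ ℝ (ℝ × ℝ)))) z :=
  ((ContinuousLinearMap.fst ℝ ℝ (ℝ × ℝ)).prod
      ((ContinuousLinearMap.fst ℝ ℝ ℝ).comp (ContinuousLinearMap.snd ℝ ℝ (ℝ × ℝ)))).hasFDerivAt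

/-- Partial derivatives of a function that is affine in `u` near a point. -/
theorem pd_of_eventuallyEq_affine {f : Pt → ℝ} {V₁ V₀ : ℝ × ℝ → ℝ} {z : Pt}
    (hf : f =ᶠ[nhds z] fun z => V₁ (tx z) * z.2.2 + V₀ (tx z))
    (h₁ : DifferentiableAt ℝ V₁ (tx z)) (h₀ : DifferentiableAt ℝ V₀ (tx z)) :
    pdT f z = fderiv ℝ V₁ (tx z) (1, 0) * z.2.2 + fderiv ℝ V₀ (tx z) (1, 0) ∧
    pdX f z = fderiv ℝ V₁ (tx z) (0, 1) * z.2.2 + fderiv ℝ V₀ (tx z) (0, 1) ∧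
    pdU f z = V₁ (tx z) := by
  have h1 := h₁.hasFDerivAt.comp z (hasFDerivAt_tx z)
  have h0 := h₀.hasFDerivAt.comp z (hasFDerivAt_tx z)
  have h2 := (hasFDerivAt_id (𝕜 := ℝ) z).snd.snd
  have h := (h1.fun_mul h2).fun_add h0
  have h' : HasFDerivAt f _ z := h.congr_of_eventuallyEq hf
  simp only [pdT, pdX, pdU, h'.fderiv]
  have h00 : ((0, 0) : ℝ × ℝ) = 0 := rfl
  simp [mul_comm, h00]

/-- Partial derivatives of a function that only depends on `(t, x)` near a point. -/
theorem pd_of_eventuallyEq_comp_tx {f : Pt → ℝ} {g : ℝ × ℝ → ℝ} {z : Pt}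
    (hf : f =ᶠ[nhds z] fun z => g (tx z)) (hg : DifferentiableAt ℝ g (tx z)) :
    pdT f z = fderiv ℝ g (tx z) (1, 0) ∧ pdX f z = fderiv ℝ g (tx z) (0, 1) ∧ pdU f z = 0 := by
  have h := pd_of_eventuallyEq_affine (f := f) (V₁ := fun _ => 0) (V₀ := g) (z := z)
    (by simpa using hf) (by fun_prop) hg
  simpa using h

theorem fderiv_comp_fst {h : ℝ → ℝ} {y : ℝ × ℝ} (hh : DifferentiableAt ℝ h y.1) (v : ℝ × ℝ) :
    fderiv ℝ (fun y : ℝ × ℝ => h y.1) y v = deriv h y.1 * v.1 := by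
  have h1 : HasFDerivAt (fun y : ℝ × ℝ => h y.1) _ y :=
    hh.hasDerivAt.comp_hasFDerivAt y (hasFDerivAt_fst (𝕜 := ℝ))
  rw [h1.fderiv]
  simp

/-- The derivative of `X¹(t) x + X⁰(t)`. -/
theorem fderiv_affine_x {X₁ X₀ : ℝ → ℝ} {y : ℝ × ℝ} (h₁ : DifferentiableAt ℝ X₁ y.1)
    (h₀ : DifferentiableAt ℝ X₀ y.1) (v : ℝ × ℝ) :
    fderiv ℝ (fun y : ℝ × ℝ => X₁ y.1 * y.2 + X₀ y.1) y v =
      (deriv X₁ y.1 * y.2 + deriv X₀ y.1) * v.1 + X₁ y.1 * v.2 := by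
  have h1 : HasFDerivAt (fun y : ℝ × ℝ => X₁ y.1) _ y :=
    h₁.hasDerivAt.comp_hasFDerivAt y (hasFDerivAt_fst (𝕜 := ℝ))
  have h0 : HasFDerivAt (fun y : ℝ × ℝ => X₀ y.1) _ y :=
    h₀.hasDerivAt.comp_hasFDerivAt y (hasFDerivAt_fst (𝕜 := ℝ))
  rw [((h1.fun_mul hasFDerivAt_snd).fun_add h0).fderiv]
  simp
  ring

theorem contDiffOn_comp_fst {Ω : Set Pt} {h : ℝ → ℝ} (hh : ContDiffOn ℝ ∞ h (Prod.fst '' Ω)) :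
    ContDiffOn ℝ ∞ (fun y : ℝ × ℝ => h y.1) (tx '' Ω) :=
  hh.comp contDiffOn_fst (by rintro _ ⟨z, hz, rfl⟩; exact ⟨z, hz, rfl⟩)

/-- The `(t, x)`-components of a transformation with `T_x = T_u = X_u = 0` and
`T_t = (X_x)² ≠ 0`. -/
theorem exists_isBaseParam {Ω : Set Pt} (hΩ : IsFibredDomain Ω) {Φ : Pt → Pt}
    (hΦ : ContDiffOn ℝ ∞ Φ Ω)
    (hT : ∀ z ∈ Ω, pdX (compT Φ) z = 0 ∧ pdU (compT Φ) z = 0)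
    (hX : ∀ z ∈ Ω, pdU (compX Φ) z = 0 ∧ pdT (compT Φ) z = pdX (compX Φ) z ^ 2)
    (hne : ∀ z ∈ Ω, pdX (compX Φ) z ≠ 0) :
    ∃ T X₁ X₀ : ℝ → ℝ, IsBaseParam (Prod.fst '' Ω) T X₁ X₀ ∧
      ∀ z ∈ Ω, compT Φ z = T z.1 ∧ compX Φ z = X₁ z.1 * z.2.1 + X₀ z.1 := by
  have hD := isOpen_tx_image hΩ.isOpen
  have hI := isOpen_fst_image hΩ.isOpen
  obtain ⟨τ, hτ, hτf⟩ := exists_eq_comp_tx hΩ (f := compT Φ) hΦ.fst fun z hz => (hT z hz).2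
  obtain ⟨g, hg, hgf⟩ := exists_eq_comp_tx hΩ (f := compX Φ) hΦ.snd.fst fun z hz => (hX z hz).1
  have near : ∀ {f : Pt → ℝ} {g : ℝ × ℝ → ℝ}, (∀ z ∈ Ω, f z = g (tx z)) → ∀ z ∈ Ω,
      f =ᶠ[nhds z] fun z => g (tx z) := by
    intro f g h z hz
    filter_upwards [hΩ.isOpen.mem_nhds hz] with w hw using h w hw
  have diff : ∀ {g : ℝ × ℝ → ℝ}, ContDiffOn ℝ ∞ g (tx '' Ω) → ∀ y ∈ tx '' Ω,
      DifferentiableAt ℝ g y := fun h y hy =>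
    (h.contDiffAt (hD.mem_nhds hy)).differentiableAt (by simp)
  have pτ := fun z hz => pd_of_eventuallyEq_comp_tx (near hτf z hz) (diff hτ _ ⟨z, hz, rfl⟩)
  have pg := fun z hz => pd_of_eventuallyEq_comp_tx (near hgf z hz) (diff hg _ ⟨z, hz, rfl⟩)
  obtain ⟨T, hTs, hTf⟩ := exists_eq_comp_fst hΩ hτ (by
    rintro _ ⟨z, hz, rfl⟩
    rw [← (pτ z hz).2.1]; exact (hT z hz).1)
  have diff1 : ∀ {h : ℝ → ℝ}, ContDiffOn ℝ ∞ h (Prod.fst '' Ω) → ∀ y ∈ tx '' Ω,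
      DifferentiableAt ℝ h y.1 := by
    rintro h hh _ ⟨z, hz, rfl⟩
    exact (hh.contDiffAt (hI.mem_nhds ⟨z, hz, rfl⟩)).differentiableAt (by simp)
  have near2 : ∀ {f g : ℝ × ℝ → ℝ}, (∀ y ∈ tx '' Ω, f y = g y) → ∀ y ∈ tx '' Ω,
      f =ᶠ[nhds y] g := by
    intro f g h y hy
    filter_upwards [hD.mem_nhds hy] with w hw using h w hw
  set gx : ℝ × ℝ → ℝ := fun y => fderiv ℝ g y (0, 1) with hgx
  have hgxs : ContDiffOn ℝ ∞ gx (tx '' Ω) := fun y hy =>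
    (contDiffAt_fderiv_apply (hg.contDiffAt (hD.mem_nhds hy)) _).contDiffWithinAt
  have hsq : ∀ y ∈ tx '' Ω, gx y * gx y = deriv T y.1 := by
    rintro _ ⟨z, hz, rfl⟩
    have h1 := (hX z hz).2
    rw [(pτ z hz).1, (pg z hz).2.1, (near2 hTf _ ⟨z, hz, rfl⟩).fderiv_eq,
      fderiv_comp_fst (diff1 hTs _ ⟨z, hz, rfl⟩)] at h1
    rw [← pow_two]
    simpa using h1.symm
  have hgx0 : ∀ y ∈ tx '' Ω, gx y ≠ 0 := by
    rintro _ ⟨z, hz, rfl⟩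
    have := hne z hz
    rwa [(pg z hz).2.1] at this
  have hTd : ContDiffOn ℝ ∞ (deriv T) (Prod.fst '' Ω) := by
    exact hTs.deriv_of_isOpen hI (by simp)
  -- `X_x² = T_t` depends on `t` only, so `2 X_x X_xx = 0`, and `X_x ≠ 0` makes `X_x` a function of
  -- `t`.
  obtain ⟨X₁, hX₁, hX₁f⟩ := exists_eq_comp_fst hΩ hgxs (by
    intro y hy
    have h1 := (diff hgxs y hy).hasFDerivAt
    have h2 := congrArg (fun L => L (0, 1)) ((near2 hsq y hy).fderiv_eq (𝕜 := ℝ))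
    simp only [fderiv_comp_fst (diff1 hTd y hy), (h1.fun_mul h1).fderiv] at h2
    simpa [hgx0 y hy] using h2)
  have hX₁c := contDiffOn_comp_fst hX₁
  obtain ⟨X₀, hX₀, hX₀f⟩ := exists_eq_comp_fst hΩ (g := fun y => g y - X₁ y.1 * y.2)
    (hg.sub (hX₁c.mul contDiffOn_snd)) (by
    intro y hy
    have h1 := (diff hg y hy).hasFDerivAt
    have h2 := (diff hX₁c y hy).hasFDerivAt
    have h3 := fderiv_comp_fst (diff1 hX₁ y hy) (0, 1)
    rw [(h1.fun_sub (h2.fun_mul hasFDerivAt_snd)).fderiv]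
    simp [h3, ← hX₁f y hy, hgx])
  refine ⟨T, X₁, X₀, ⟨hTs, hX₁, hX₀, ?_, ?_⟩, ?_⟩
  · rintro _ ⟨z, hz, rfl⟩
    have := hgx0 _ ⟨z, hz, rfl⟩
    rwa [hX₁f _ ⟨z, hz, rfl⟩] at this
  · rintro _ ⟨z, hz, rfl⟩
    have := hsq _ ⟨z, hz, rfl⟩
    rw [hX₁f _ ⟨z, hz, rfl⟩] at this
    rw [pow_two]; exact this.symm
  · intro z hz
    refine ⟨by rw [hτf z hz, hTf _ ⟨z, hz, rfl⟩]; rfl, ?_⟩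
    have := hX₀f _ ⟨z, hz, rfl⟩
    rw [hgf z hz]
    simp only [tx] at this ⊢
    linarith

/-! ### Transformations that are affine in `x` and `u` -/

theorem differentiableAt_of_contDiffOn {E F : Type*} [NormedAddCommGroup E] [NormedSpace ℝ E]
    [NormedAddCommGroup F] [NormedSpace ℝ F] {f : E → F} {s : Set E} {x : E}
    (hf : ContDiffOn ℝ ∞ f s) (hs : IsOpen s) (hx : x ∈ s) : DifferentiableAt ℝ f x :=
  (hf.contDiffAt (hs.mem_nhds hx)).differentiableAt (by simp)

theorem contDiffOn_fderiv_apply {E F : Type*} [NormedAddCommGroup E] [NormedSpace ℝ E]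
    [NormedAddCommGroup F] [NormedSpace ℝ F] {f : E → F} {s : Set E}
    (hf : ContDiffOn ℝ ∞ f s) (hs : IsOpen s) (v : E) :
    ContDiffOn ℝ ∞ (fun y => fderiv ℝ f y v) s := fun _ hy =>
  (contDiffAt_fderiv_apply (hf.contDiffAt (hs.mem_nhds hy)) v).contDiffWithinAt

theorem pd_compT_of_form {Ω : Set Pt} (hΩ : IsOpen Ω) {Φ : Pt → Pt} {T X₁ X₀ : ℝ → ℝ}
    (hb : IsBaseParam (Prod.fst '' Ω) T X₁ X₀) (hT : ∀ z ∈ Ω, compT Φ z = T z.1)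
    {z : Pt} (hz : z ∈ Ω) :
    pdT (compT Φ) z = X₁ z.1 ^ 2 ∧ pdX (compT Φ) z = 0 ∧ pdU (compT Φ) z = 0 := by
  have hd : DifferentiableAt ℝ T (tx z).1 :=
    differentiableAt_of_contDiffOn hb.smooth_T (isOpen_fst_image hΩ) ⟨z, hz, rfl⟩
  have hd2 : DifferentiableAt ℝ (fun y : ℝ × ℝ => T y.1) (tx z) :=
    hd.comp (tx z) differentiableAt_fst
  have h := pd_of_eventuallyEq_comp_tx (f := compT Φ) (g := fun y => T y.1) (z := z)
    (by filter_upwards [hΩ.mem_nhds hz] with w hw using hT w hw) hd2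
  rw [fderiv_comp_fst hd, fderiv_comp_fst hd] at h
  refine ⟨?_, by simpa using h.2.1, h.2.2⟩
  rw [h.1]
  simpa [tx] using hb.deriv_T z.1 ⟨z, hz, rfl⟩

theorem pd_compX_of_form {Ω : Set Pt} (hΩ : IsOpen Ω) {Φ : Pt → Pt} {T X₁ X₀ : ℝ → ℝ}
    (hb : IsBaseParam (Prod.fst '' Ω) T X₁ X₀)
    (hX : ∀ z ∈ Ω, compX Φ z = X₁ z.1 * z.2.1 + X₀ z.1) {z : Pt} (hz : z ∈ Ω) :
    pdT (compX Φ) z = deriv X₁ z.1 * z.2.1 + deriv X₀ z.1 ∧ pdX (compX Φ) z = X₁ z.1 ∧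
      pdU (compX Φ) z = 0 := by
  have hI := isOpen_fst_image hΩ
  have hd1 : DifferentiableAt ℝ X₁ (tx z).1 :=
    differentiableAt_of_contDiffOn hb.smooth_X₁ hI ⟨z, hz, rfl⟩
  have hd0 : DifferentiableAt ℝ X₀ (tx z).1 :=
    differentiableAt_of_contDiffOn hb.smooth_X₀ hI ⟨z, hz, rfl⟩
  have hd2 : DifferentiableAt ℝ (fun y : ℝ × ℝ => X₁ y.1 * y.2 + X₀ y.1) (tx z) :=
    ((hd1.comp (tx z) differentiableAt_fst).mul differentiableAt_snd).add
      (hd0.comp (tx z) differentiableAt_fst)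
  have h := pd_of_eventuallyEq_comp_tx (f := compX Φ)
    (g := fun y => X₁ y.1 * y.2 + X₀ y.1) (z := z)
    (by filter_upwards [hΩ.mem_nhds hz] with w hw using hX w hw) hd2
  rw [fderiv_affine_x hd1 hd0, fderiv_affine_x hd1 hd0] at h
  refine ⟨?_, by simpa [tx] using h.2.1, h.2.2⟩
  rw [h.1]
  simp [tx]

theorem totXX_compX_of_form {Ω : Set Pt} (hΩ : IsOpen Ω) {Φ : Pt → Pt} {T X₁ X₀ : ℝ → ℝ}
    (hb : IsBaseParam (Prod.fst '' Ω) T X₁ X₀)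
    (hX : ∀ z ∈ Ω, compX Φ z = X₁ z.1 * z.2.1 + X₀ z.1) {z : Pt} (hz : z ∈ Ω) (q : ℝ) :
    totXX (compX Φ) z q = 0 := by
  have hI := isOpen_fst_image hΩ
  have hd1 : DifferentiableAt ℝ X₁ (tx z).1 :=
    differentiableAt_of_contDiffOn hb.smooth_X₁ hI ⟨z, hz, rfl⟩
  have hd : DifferentiableAt ℝ (fun y : ℝ × ℝ => X₁ y.1) (tx z) :=
    hd1.comp (tx z) differentiableAt_fst
  have h1 := pd_of_eventuallyEq_comp_tx (f := pdX (compX Φ)) (g := fun y => X₁ y.1) (z := z)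
    (by filter_upwards [hΩ.mem_nhds hz] with w hw using (pd_compX_of_form hΩ hb hX hw).2.1) hd
  have h2 := pd_of_eventuallyEq_comp_tx (f := pdU (compX Φ)) (g := fun _ => 0) (z := z)
    (by filter_upwards [hΩ.mem_nhds hz] with w hw using (pd_compX_of_form hΩ hb hX hw).2.2)
    (by fun_prop)
  rw [fderiv_comp_fst hd1, fderiv_comp_fst hd1] at h1
  simp [totXX, h1, h2]

theorem pd_compU_of_form {Ω : Set Pt} (hΩ : IsOpen Ω) {Φ : Pt → Pt} {U₁ U₀ : ℝ × ℝ → ℝ}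
    (h₁ : ContDiffOn ℝ ∞ U₁ (tx '' Ω)) (h₀ : ContDiffOn ℝ ∞ U₀ (tx '' Ω))
    (hU : ∀ z ∈ Ω, compU Φ z = U₁ (tx z) * z.2.2 + U₀ (tx z)) {z : Pt} (hz : z ∈ Ω) :
    pdT (compU Φ) z = fderiv ℝ U₁ (tx z) (1, 0) * z.2.2 + fderiv ℝ U₀ (tx z) (1, 0) ∧
    pdX (compU Φ) z = fderiv ℝ U₁ (tx z) (0, 1) * z.2.2 + fderiv ℝ U₀ (tx z) (0, 1) ∧
    pdU (compU Φ) z = U₁ (tx z) := by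
  have hD := isOpen_tx_image hΩ
  exact pd_of_eventuallyEq_affine
    (by filter_upwards [hΩ.mem_nhds hz] with w hw using hU w hw)
    (differentiableAt_of_contDiffOn h₁ hD ⟨z, hz, rfl⟩)
    (differentiableAt_of_contDiffOn h₀ hD ⟨z, hz, rfl⟩)

theorem pd_pd_compU_of_form {Ω : Set Pt} (hΩ : IsOpen Ω) {Φ : Pt → Pt} {U₁ U₀ : ℝ × ℝ → ℝ}
    (h₁ : ContDiffOn ℝ ∞ U₁ (tx '' Ω)) (h₀ : ContDiffOn ℝ ∞ U₀ (tx '' Ω))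
    (hU : ∀ z ∈ Ω, compU Φ z = U₁ (tx z) * z.2.2 + U₀ (tx z)) {z : Pt} (hz : z ∈ Ω) :
    pdX (pdX (compU Φ)) z =
      fderiv ℝ (fun y => fderiv ℝ U₁ y (0, 1)) (tx z) (0, 1) * z.2.2 +
        fderiv ℝ (fun y => fderiv ℝ U₀ y (0, 1)) (tx z) (0, 1) ∧
    pdU (pdX (compU Φ)) z = fderiv ℝ U₁ (tx z) (0, 1) ∧
    pdX (pdU (compU Φ)) z = fderiv ℝ U₁ (tx z) (0, 1) ∧
    pdU (pdU (compU Φ)) z = 0 := by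
  have hD := isOpen_tx_image hΩ
  have hx := pd_of_eventuallyEq_affine (f := pdX (compU Φ)) (z := z)
    (V₁ := fun y => fderiv ℝ U₁ y (0, 1)) (V₀ := fun y => fderiv ℝ U₀ y (0, 1))
    (by filter_upwards [hΩ.mem_nhds hz] with w hw using (pd_compU_of_form hΩ h₁ h₀ hU hw).2.1)
    (differentiableAt_of_contDiffOn (contDiffOn_fderiv_apply h₁ hD _) hD ⟨z, hz, rfl⟩)
    (differentiableAt_of_contDiffOn (contDiffOn_fderiv_apply h₀ hD _) hD ⟨z, hz, rfl⟩)
  have hu := pd_of_eventuallyEq_comp_tx (f := pdU (compU Φ)) (z := z) (g := U₁)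
    (by filter_upwards [hΩ.mem_nhds hz] with w hw using (pd_compU_of_form hΩ h₁ h₀ hU hw).2.2)
    (differentiableAt_of_contDiffOn h₁ hD ⟨z, hz, rfl⟩)
  exact ⟨hx.2.1, hx.2.2, hu.2.1, hu.2.2⟩

theorem contDiffOn_affineMap {Ω : Set Pt} {T X₁ X₀ : ℝ → ℝ} {U₁ U₀ : ℝ × ℝ → ℝ}
    (hb : IsBaseParam (Prod.fst '' Ω) T X₁ X₀) (h₁ : ContDiffOn ℝ ∞ U₁ (tx '' Ω))
    (h₀ : ContDiffOn ℝ ∞ U₀ (tx '' Ω)) :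
    ContDiffOn ℝ ∞ (affineMap T X₁ X₀ U₁ U₀) Ω := by
  have hf : ∀ {h : ℝ → ℝ}, ContDiffOn ℝ ∞ h (Prod.fst '' Ω) →
      ContDiffOn ℝ ∞ (fun z : Pt => h z.1) Ω := fun hh =>
    hh.comp contDiffOn_fst (mapsTo_image _ _)
  have hg : ∀ {h : ℝ × ℝ → ℝ}, ContDiffOn ℝ ∞ h (tx '' Ω) →
      ContDiffOn ℝ ∞ (fun z : Pt => h (tx z)) Ω := fun hh =>
    hh.comp (by unfold tx; fun_prop) (mapsTo_image _ _)
  exact (hf hb.smooth_T).prodMk ((((hf hb.smooth_X₁).mul (by fun_prop)).add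
    (hf hb.smooth_X₀)).prodMk (((hg h₁).mul (by fun_prop)).add (hg h₀)))

theorem totJac_of_form {Ω : Set Pt} (hΩ : IsOpen Ω) {Φ : Pt → Pt} {T X₁ X₀ : ℝ → ℝ}
    (hb : IsBaseParam (Prod.fst '' Ω) T X₁ X₀) (hT : ∀ z ∈ Ω, compT Φ z = T z.1)
    (hX : ∀ z ∈ Ω, compX Φ z = X₁ z.1 * z.2.1 + X₀ z.1) {j : Jet1} (hj : j.1 ∈ Ω) :
    totJac Φ j = X₁ j.1.1 ^ 3 := by
  have h1 := pd_compT_of_form hΩ hb hT hj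
  have h2 := pd_compX_of_form hΩ hb hX hj
  rw [totJac_eq_of_pd_compT h1.2.1 h1.2.2, totX_eq, h1.1, h2.2.1, h2.2.2]
  ring

/-- The transformed equation, for a transformation that is affine in `x` and `u`. -/
theorem prolong_equation_iff_of_form {ε : ℝ} (hε : ε ^ 2 = 1) {Ω : Set Pt} (hΩ : IsOpen Ω)
    {Φ : Pt → Pt} {T X₁ X₀ : ℝ → ℝ} {U₁ U₀ : ℝ × ℝ → ℝ}
    (hb : IsBaseParam (Prod.fst '' Ω) T X₁ X₀) (h₁ : ContDiffOn ℝ ∞ U₁ (tx '' Ω))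
    (h₀ : ContDiffOn ℝ ∞ U₀ (tx '' Ω)) (hΦ : ∀ z ∈ Ω, Φ z = affineMap T X₁ X₀ U₁ U₀ z)
    {z : Pt} (hz : z ∈ Ω) (p q m n b β : ℝ) :
    prT Φ (z, (p, q)) =
        ε * prXX Φ ((z, (p, q)), (m, n, ε * (p - b * q))) + β * prX Φ (z, (p, q)) ↔
      fderiv ℝ U₁ (tx z) (1, 0) * z.2.2 + fderiv ℝ U₀ (tx z) (1, 0) + b * q * U₁ (tx z) -
          (fderiv ℝ U₁ (tx z) (0, 1) * z.2.2 + fderiv ℝ U₀ (tx z) (0, 1) + q * U₁ (tx z)) *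
            (deriv X₁ z.1 * z.2.1 + deriv X₀ z.1) / X₁ z.1 =
        ε * (fderiv ℝ (fun y => fderiv ℝ U₁ y (0, 1)) (tx z) (0, 1) * z.2.2 +
          fderiv ℝ (fun y => fderiv ℝ U₀ y (0, 1)) (tx z) (0, 1) +
            2 * q * fderiv ℝ U₁ (tx z) (0, 1)) +
          β * X₁ z.1 *
            (fderiv ℝ U₁ (tx z) (0, 1) * z.2.2 + fderiv ℝ U₀ (tx z) (0, 1) + q * U₁ (tx z)) := by
  have cT : ∀ z ∈ Ω, compT Φ z = T z.1 := fun z hz => by rw [compT, hΦ z hz]; rfl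
  have cX : ∀ z ∈ Ω, compX Φ z = X₁ z.1 * z.2.1 + X₀ z.1 := fun z hz => by
    rw [compX, hΦ z hz]; rfl
  have cU : ∀ z ∈ Ω, compU Φ z = U₁ (tx z) * z.2.2 + U₀ (tx z) := fun z hz => by
    rw [compU, hΦ z hz]; rfl
  have hs : ContDiffAt ℝ ∞ Φ z :=
    ((contDiffOn_affineMap hb h₁ h₀).congr hΦ).contDiffAt (hΩ.mem_nhds hz)
  have pT := pd_compT_of_form hΩ hb cT hz
  have pX := pd_compX_of_form hΩ hb cX hz
  have pU := pd_compU_of_form hΩ h₁ h₀ cU hz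
  have pUU := pd_pd_compU_of_form hΩ h₁ h₀ cU hz
  have hJ : totJac Φ (z, (p, q)) ≠ 0 := by
    rw [totJac_of_form hΩ hb cT cX (by exact hz)]
    exact pow_ne_zero _ (hb.X₁_ne_zero _ ⟨z, hz, rfl⟩)
  rw [prolong_equation_iff hε hs
    (by filter_upwards [hΩ.mem_nhds hz] with w hw using (pd_compT_of_form hΩ hb cT hw).2)
    (by rw [pT.1, pX.2.1]) pX.2.2 (totXX_compX_of_form hΩ hb cX hz q) hJ b β m n,
    pX.1, pX.2.1, pU.1, pU.2.1, pU.2.2, totXX, pUU.1, pUU.2.1, pUU.2.2.1, pUU.2.2.2]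
  refine Eq.congr rfl ?_
  ring

/-! ### The solution conditions on `1/U¹` and `U⁰/U¹` -/

/-- `U¹` times the residual of `V` in the equation that `U¹` and `U⁰` satisfy when `1/U¹` and
`U⁰/U¹` solve the equation with drift value `b`. -/
noncomputable def fibreResidual (ε b : ℝ) (U₁ V : ℝ × ℝ → ℝ) (y : ℝ × ℝ) : ℝ :=
  (fderiv ℝ V y (1, 0) - ε * fderiv ℝ (fun y' => fderiv ℝ V y' (0, 1)) y (0, 1)) * U₁ y -
    (b * U₁ y - 2 * ε * fderiv ℝ U₁ y (0, 1)) * fderiv ℝ V y (0, 1)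

/-- Two applications of the quotient rule. This turns statements about quotients by `U¹` into
statements about `U¹` and `V` themselves. -/
theorem residual_div {ε b : ℝ} {D : Set (ℝ × ℝ)} (hD : IsOpen D) {U₁ V : ℝ × ℝ → ℝ}
    (h₁ : ContDiffOn ℝ ∞ U₁ D) (hV : ContDiffOn ℝ ∞ V D) (hne : ∀ y ∈ D, U₁ y ≠ 0)
    {y : ℝ × ℝ} (hy : y ∈ D) :
    fderiv ℝ (fun y => V y / U₁ y) y (1, 0) -
      (ε * fderiv ℝ (fun y' => fderiv ℝ (fun y => V y / U₁ y) y' (0, 1)) y (0, 1) +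
        b * fderiv ℝ (fun y => V y / U₁ y) y (0, 1)) =
    (fibreResidual ε b U₁ V y * U₁ y - V y * fibreResidual ε b U₁ U₁ y) / U₁ y ^ 3 := by
  have d1 := fun w (hw : w ∈ D) => differentiableAt_of_contDiffOn h₁ hD hw
  have dV := fun w (hw : w ∈ D) => differentiableAt_of_contDiffOn hV hD hw
  have d1x := differentiableAt_of_contDiffOn (contDiffOn_fderiv_apply h₁ hD (0, 1)) hD hy
  have dVx := differentiableAt_of_contDiffOn (contDiffOn_fderiv_apply hV hD (0, 1)) hD hy
  have hev : (fun y' => fderiv ℝ (fun y => V y / U₁ y) y' (0, 1)) =ᶠ[nhds y]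
      fun w => (fderiv ℝ V w (0, 1) * U₁ w - V w * fderiv ℝ U₁ w (0, 1)) / (U₁ w * U₁ w) := by
    filter_upwards [hD.mem_nhds hy] with w hw
    rw [fderiv_div_apply (dV w hw) (d1 w hw) (hne w hw), pow_two]
  have hn := (dVx.hasFDerivAt.fun_mul (d1 y hy).hasFDerivAt).fun_sub
    ((dV y hy).hasFDerivAt.fun_mul d1x.hasFDerivAt)
  have hd := (d1 y hy).hasFDerivAt.fun_mul (d1 y hy).hasFDerivAt
  have h0 := hne y hy
  rw [hev.fderiv_eq, fderiv_div_apply hn.differentiableAt hd.differentiableAt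
    (mul_ne_zero h0 h0), hn.fderiv, hd.fderiv, fderiv_div_apply (dV y hy) (d1 y hy) h0,
    fderiv_div_apply (dV y hy) (d1 y hy) h0]
  simp only [fibreResidual, sub_apply, add_apply, smul_apply, smul_eq_mul]
  field_simp
  ring

/-- In `residual_div`, taking `V = 1` (whose `fibreResidual` is zero) handles `1/U¹`, and `V = U⁰`
handles `U⁰/U¹`; the resulting system is triangular. -/
theorem isFibreParam_iff {ε : ℝ} {B : ℝ × ℝ → ℝ} {D : Set (ℝ × ℝ)} (hD : IsOpen D)
    {U₁ U₀ : ℝ × ℝ → ℝ} (h₁ : ContDiffOn ℝ ∞ U₁ D) (h₀ : ContDiffOn ℝ ∞ U₀ D)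
    (hne : ∀ y ∈ D, U₁ y ≠ 0) :
    IsFibreParam ε B D U₁ U₀ ↔ ∀ y ∈ D,
      fibreResidual ε (B y) U₁ U₁ y = 0 ∧ fibreResidual ε (B y) U₁ U₀ y = 0 := by
  have hone : ∀ y, fibreResidual ε (B y) U₁ (fun _ => 1) y = 0 := by
    intro y; simp [fibreResidual]
  constructor
  · intro h y hy
    have e1 := residual_div (ε := ε) (b := B y) hD h₁ (contDiffOn_const (c := (1 : ℝ))) hne hy
    have e0 := residual_div (ε := ε) (b := B y) hD h₁ h₀ hne hy
    rw [sub_eq_zero.2 (h.solution_inv.2 y hy), hone] at e1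
    rw [sub_eq_zero.2 (h.solution_div.2 y hy)] at e0
    have h0 := hne y hy
    have r1 : fibreResidual ε (B y) U₁ U₁ y = 0 := by
      field_simp at e1
      linarith
    rw [r1] at e0
    refine ⟨r1, ?_⟩
    simpa [h0] using e0.symm
  · intro h
    refine ⟨h₁, h₀, hne, ⟨contDiffOn_const.div h₁ hne, fun y hy => ?_⟩,
      ⟨h₀.div h₁ hne, fun y hy => ?_⟩⟩
    · have e1 := residual_div (ε := ε) (b := B y) hD h₁ (contDiffOn_const (c := (1 : ℝ))) hne hy
      rw [(h y hy).1, hone] at e1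
      exact sub_eq_zero.1 (by simpa using e1)
    · have e1 := residual_div (ε := ε) (b := B y) hD h₁ h₀ hne hy
      rw [(h y hy).1, (h y hy).2] at e1
      exact sub_eq_zero.1 (by simpa using e1)

/-! ### The transformations that connect equations of the class -/

/-- A transformation that connects, near some jet over each point, equations with constant drift
is affine in `x` and `u`. -/
theorem exists_affine_form {ε : ℝ} (hε : ε ^ 2 = 1) {Ω : Set Pt} (hΩ : IsFibredDomain Ω)
    {Φ : Pt → Pt} (hΦ : ContDiffOn ℝ ∞ Φ Ω)
    (hbij : ∀ z ∈ Ω, Function.Bijective (fderiv ℝ Φ z))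
    (hc : ∀ z ∈ Ω, ∃ b β, ConnectsNear ε b β Φ z) :
    ∃ (T X₁ X₀ : ℝ → ℝ) (U₁ U₀ : ℝ × ℝ → ℝ),
      IsBaseParam (Prod.fst '' Ω) T X₁ X₀ ∧
      ContDiffOn ℝ ∞ U₁ (tx '' Ω) ∧ ContDiffOn ℝ ∞ U₀ (tx '' Ω) ∧
      (∀ y ∈ tx '' Ω, U₁ y ≠ 0) ∧
      (∀ z ∈ Ω, Φ z = affineMap T X₁ X₀ U₁ U₀ z) ∧
      ∀ z ∈ Ω, ∀ b β, ConnectsNear ε b β Φ z →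
        β = 1 / X₁ z.1 * (b - 2 * ε * (fderiv ℝ U₁ (tx z) (0, 1) / U₁ (tx z))) -
          (deriv X₁ z.1 * z.2.1 + deriv X₀ z.1) / X₁ z.1 ^ 2 ∧
        fibreResidual ε b U₁ U₁ (tx z) * z.2.2 + fibreResidual ε b U₁ U₀ (tx z) = 0 := by
  have hs : ∀ z ∈ Ω, ContDiffAt ℝ ∞ Φ z := fun z hz => hΦ.contDiffAt (hΩ.isOpen.mem_nhds hz)
  have hdet : ∀ z ∈ Ω, jacDet Φ z ≠ 0 := fun z hz =>
    jacDet_ne_zero ((hs z hz).differentiableAt (by simp)) (hbij z hz)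
  have hT : ∀ z ∈ Ω, pdX (compT Φ) z = 0 ∧ pdU (compT Φ) z = 0 := by
    intro z hz
    obtain ⟨b, β, h⟩ := hc z hz
    exact h.pd_compT hε (hs z hz) (hdet z hz)
  have hT' : ∀ z ∈ Ω, ∀ᶠ z' in nhds z, pdX (compT Φ) z' = 0 ∧ pdU (compT Φ) z' = 0 := by
    intro z hz
    filter_upwards [hΩ.isOpen.mem_nhds hz] with w hw using hT w hw
  have hX : ∀ z ∈ Ω, pdU (compX Φ) z = 0 ∧ pdT (compT Φ) z = pdX (compX Φ) z ^ 2 := by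
    intro z hz
    obtain ⟨b, β, h⟩ := hc z hz
    exact h.pd_compX hε (hs z hz) (hdet z hz) (hT' z hz)
  have hne : ∀ z ∈ Ω, pdX (compX Φ) z ≠ 0 ∧ pdU (compU Φ) z ≠ 0 := by
    intro z hz
    have h := hdet z hz
    rw [jacDet, (hT z hz).1, (hT z hz).2, (hX z hz).1] at h
    constructor <;> intro h0 <;> apply h <;> rw [h0] <;> ring
  obtain ⟨T, X₁, X₀, hb, hform⟩ := exists_isBaseParam hΩ hΦ hT hX fun z hz => (hne z hz).1
  have cT : ∀ z ∈ Ω, compT Φ z = T z.1 := fun z hz => (hform z hz).1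
  have cX : ∀ z ∈ Ω, compX Φ z = X₁ z.1 * z.2.1 + X₀ z.1 := fun z hz => (hform z hz).2
  have hXX := fun z (hz : z ∈ Ω) => totXX_compX_of_form hΩ.isOpen hb cX hz
  have hUu : ∀ z ∈ Ω, pdU (pdU (compU Φ)) z = 0 := by
    intro z hz
    obtain ⟨b, β, h⟩ := hc z hz
    exact (h.pd_compU hε (hs z hz) (hT' z hz) (hX z hz).2 (hX z hz).1 (hXX z hz)).1
  have sUu : ContDiffOn ℝ ∞ (pdU (compU Φ)) Ω := fun z hz =>
    (contDiffAt_pdU (contDiffAt_compU (hs z hz))).contDiffWithinAt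
  obtain ⟨U₁, hU₁, fU₁⟩ := exists_eq_comp_tx hΩ sUu hUu
  have sU : ContDiffOn ℝ ∞ (compU Φ) Ω := hΦ.snd.snd
  -- The `u`-derivative of `U - U_u u` is `-U_uu u = 0`.
  obtain ⟨U₀, hU₀, fU₀⟩ := exists_eq_comp_tx hΩ
    (f := fun z => compU Φ z - pdU (compU Φ) z * z.2.2)
    (sU.sub (sUu.mul (by fun_prop))) (by
      intro z hz
      have e1 := (differentiableAt_of_contDiffOn sU hΩ.isOpen hz).hasFDerivAt
      have e2 := (differentiableAt_of_contDiffOn sUu hΩ.isOpen hz).hasFDerivAt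
      have e3 := (hasFDerivAt_id (𝕜 := ℝ) z).snd.snd
      have e4 := e1.fun_sub (e2.fun_mul e3)
      simp only [id_eq] at e4
      have e5 : fderiv ℝ (pdU (compU Φ)) z (0, 0, 1) = 0 := hUu z hz
      rw [pdU, HasFDerivAt.fderiv e4]
      simp [e5, pdU])
  have cU : ∀ z ∈ Ω, compU Φ z = U₁ (tx z) * z.2.2 + U₀ (tx z) := by
    intro z hz
    rw [← fU₁ z hz, ← fU₀ z hz]
    ring
  have neU : ∀ y ∈ tx '' Ω, U₁ y ≠ 0 := by
    rintro _ ⟨z, hz, rfl⟩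
    rw [← fU₁ z hz]
    exact (hne z hz).2
  refine ⟨T, X₁, X₀, U₁, U₀, hb, hU₁, hU₀, neU, ?_, ?_⟩
  · intro z hz
    exact Prod.ext (cT z hz) (Prod.ext (cX z hz) (cU z hz))
  · intro z hz b β h
    have h1 := h.pd_compU hε (hs z hz) (hT' z hz) (hX z hz).2 (hX z hz).1 (hXX z hz)
    have pX := pd_compX_of_form hΩ.isOpen hb cX hz
    have pU := pd_compU_of_form hΩ.isOpen hU₁ hU₀ cU hz
    have pUU := pd_pd_compU_of_form hΩ.isOpen hU₁ hU₀ cU hz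
    rw [pX.1, pX.2.1, pU.1, pU.2.1, pU.2.2, pUU.1, pUU.2.1, pUU.2.2.1] at h1
    obtain ⟨-, h2, h3⟩ := h1
    have n1 := neU _ ⟨z, hz, rfl⟩
    have n2 := hb.X₁_ne_zero _ ⟨z, hz, rfl⟩
    set S := deriv X₁ z.1 * z.2.1 + deriv X₀ z.1
    set a := X₁ z.1
    constructor
    · have : β * a = b - S / a - 2 * ε * (fderiv ℝ U₁ (tx z) (0, 1) / U₁ (tx z)) := by
        field_simp at h2 ⊢
        linear_combination -h2
      rw [eq_div_iff n2 |>.2 this]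
      field_simp
      ring
    · simp only [fibreResidual]
      -- This combination eliminates `β` and `X_t`, leaving an equation that involves only the
      -- source drift value.
      linear_combination U₁ (tx z) * h3 -
        (fderiv ℝ U₁ (tx z) (0, 1) * z.2.2 + fderiv ℝ U₀ (tx z) (0, 1)) * h2

/-- The total Jacobian is affine in `(u_t, u_x)`, and its coefficients are, up to sign, the `2 × 2`
minors in the expansion of the determinant along the row of `U`. -/
theorem exists_totJac_ne_zero {Φ : Pt → Pt} {z : Pt} (hdet : jacDet Φ z ≠ 0) :
    ∃ p q : ℝ, totJac Φ (z, (p, q)) ≠ 0 := by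
  by_contra! h
  have h00 := h 0 0
  have h10 := h 1 0
  have h01 := h 0 1
  simp only [totJac, totT_eq, totX_eq] at h00 h10 h01
  apply hdet
  rw [jacDet]
  linear_combination pdU (compU Φ) z * h00 - pdT (compU Φ) z * (h10 - h00) -
    pdX (compU Φ) z * (h01 - h00)

theorem Connects.connectsNear {ε : ℝ} (hε : ε ^ 2 = 1) {Ω : Set Pt} {B B' : ℝ × ℝ → ℝ}
    {Φ : Pt → Pt} (h : Connects ε Ω B Φ B') {z : Pt} (hz : z ∈ Ω) (hΦ : ContDiffAt ℝ ∞ Φ z)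
    (hdet : jacDet Φ z ≠ 0) : ConnectsNear ε (B (tx z)) (B' (tx (Φ z))) Φ z := by
  obtain ⟨p₀, q₀, hJ⟩ := exists_totJac_ne_zero hdet
  have hcont : ContinuousAt (fun y : ℝ × ℝ => totJac Φ (z, y)) (p₀, q₀) :=
    ContinuousAt.comp (g := totJac Φ) (contDiffAt_totJac (j := (z, (p₀, q₀))) hΦ).continuousAt
      (by fun_prop)
  obtain ⟨r, hr, hr'⟩ := Metric.eventually_nhds_iff.1 (hcont.eventually_ne hJ)
  -- The centre for `u_tt, u_tx` is arbitrary: neither the total Jacobian nor the source equation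
  -- involves them.
  refine ⟨p₀, q₀, 0, 0, r, hr, fun p q m n hp hq _ _ => ?_⟩
  have hJ' : totJac Φ (z, (p, q)) ≠ 0 := hr' (by
    rw [Prod.dist_eq]
    exact max_lt hp hq)
  refine ⟨hJ', ?_⟩
  refine h ((z, (p, q)), (m, n, ε * (p - B (tx z) * q))) hz hJ' ?_
  show p = ε * (ε * (p - B (tx z) * q)) + B (tx z) * q
  linear_combination -(p - B (tx z) * q) * hε

theorem exists_mem_fibre_ne {Ω : Set Pt} (hΩ : IsOpen Ω) {z : Pt} (hz : z ∈ Ω) :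
    ∃ u, u ≠ z.2.2 ∧ (z.1, z.2.1, u) ∈ Ω := by
  have h : ∀ᶠ u in nhds z.2.2, (z.1, z.2.1, u) ∈ Ω :=
    (hΩ.preimage (f := fun u : ℝ => ((z.1, z.2.1, u) : Pt)) (by fun_prop)).mem_nhds hz
  obtain ⟨r, hr, hr'⟩ := Metric.eventually_nhds_iff.1 h
  refine ⟨z.2.2 + r / 2, by linarith, hr' ?_⟩
  rw [Real.dist_eq, add_sub_cancel_left, abs_of_pos (by linarith)]
  linarith

/-- Coefficients of a function affine in `u` that vanishes on `Ω`. -/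
theorem eq_zero_of_affine_eq_zero {Ω : Set Pt} (hΩ : IsOpen Ω) {f g : ℝ × ℝ → ℝ}
    (h : ∀ z ∈ Ω, f (tx z) * z.2.2 + g (tx z) = 0) : ∀ y ∈ tx '' Ω, f y = 0 ∧ g y = 0 := by
  rintro _ ⟨z, hz, rfl⟩
  obtain ⟨u, hu, hz'⟩ := exists_mem_fibre_ne hΩ hz
  have e1 := h z hz
  have e2 := h _ hz'
  rw [show tx (z.1, z.2.1, u) = tx z from rfl] at e2
  have e3 : f (tx z) * (u - z.2.2) = 0 := by linear_combination e2 - e1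
  have e4 := (mul_eq_zero.1 e3).resolve_right (sub_ne_zero.2 hu)
  refine ⟨e4, ?_⟩
  rw [e4] at e1
  linarith

/-- A transformation of the stated form maps the equation with drift value `b` to the one with
the transformed drift value. -/
theorem prolong_equation_of_form {ε : ℝ} (hε : ε ^ 2 = 1) {Ω : Set Pt} (hΩ : IsOpen Ω)
    {Φ : Pt → Pt} {T X₁ X₀ : ℝ → ℝ} {U₁ U₀ : ℝ × ℝ → ℝ}
    (hb : IsBaseParam (Prod.fst '' Ω) T X₁ X₀) (h₁ : ContDiffOn ℝ ∞ U₁ (tx '' Ω))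
    (h₀ : ContDiffOn ℝ ∞ U₀ (tx '' Ω)) (hne : ∀ y ∈ tx '' Ω, U₁ y ≠ 0)
    (hΦ : ∀ z ∈ Ω, Φ z = affineMap T X₁ X₀ U₁ U₀ z) {b : ℝ}
    {j : Jet2} (hj : j.1.1 ∈ Ω) (hres₁ : fibreResidual ε b U₁ U₁ (jetTX j) = 0)
    (hres₀ : fibreResidual ε b U₁ U₀ (jetTX j) = 0)
    (heq : j.1.2.1 = ε * j.2.2.2 + b * j.1.2.2) :
    prT Φ j.1 = ε * prXX Φ j + (1 / X₁ j.1.1.1 *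
        (b - 2 * ε * (fderiv ℝ U₁ (jetTX j) (0, 1) / U₁ (jetTX j))) -
          (deriv X₁ j.1.1.1 * j.1.1.2.1 + deriv X₀ j.1.1.1) / X₁ j.1.1.1 ^ 2) * prX Φ j.1 := by
  obtain ⟨⟨z, p, q⟩, m, n, s⟩ := j
  simp only [jetTX] at *
  have hsub : s = ε * (p - b * q) := by linear_combination -ε * heq - s * hε
  subst hsub
  rw [prolong_equation_iff_of_form hε hΩ hb h₁ h₀ hΦ hj p q m n b]
  have n1 := hne _ ⟨z, hj, rfl⟩
  have n2 := hb.X₁_ne_zero _ ⟨z, hj, rfl⟩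
  simp only [fibreResidual] at hres₁ hres₀
  set S := deriv X₁ z.1 * z.2.1 + deriv X₀ z.1
  set a := X₁ z.1
  field_simp
  linear_combination a * hres₀ + a * z.2.2 * hres₁

theorem connects_iff {ε : ℝ} (hε : ε ^ 2 = 1) {Ω : Set Pt} {B B' : ℝ × ℝ → ℝ} {Φ : Pt → Pt}
    (hΩ : IsFibredDomain Ω) (hΦ : IsPointTransformation Φ Ω) :
    Connects ε Ω B Φ B' ↔
      ∃ (T X₁ X₀ : ℝ → ℝ) (U₁ U₀ : ℝ × ℝ → ℝ),
        IsBaseParam (Prod.fst '' Ω) T X₁ X₀ ∧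
        IsFibreParam ε B (tx '' Ω) U₁ U₀ ∧
        (∀ z ∈ Ω, Φ z = affineMap T X₁ X₀ U₁ U₀ z) ∧
        ∀ t x : ℝ, (t, x) ∈ tx '' Ω →
          B' (T t, X₁ t * x + X₀ t) =
            1 / X₁ t * (B (t, x) - 2 * ε * (fderiv ℝ U₁ (t, x) (0, 1) / U₁ (t, x))) -
              (deriv X₁ t * x + deriv X₀ t) / X₁ t ^ 2 := by
  have hD := isOpen_tx_image hΩ.isOpen
  constructor
  · intro h
    have hs : ∀ z ∈ Ω, ContDiffAt ℝ ∞ Φ z := fun z hz =>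
      hΦ.smooth.contDiffAt (hΩ.isOpen.mem_nhds hz)
    have hn : ∀ z ∈ Ω, ConnectsNear ε (B (tx z)) (B' (tx (Φ z))) Φ z := fun z hz =>
      h.connectsNear hε hz (hs z hz)
        (jacDet_ne_zero ((hs z hz).differentiableAt (by simp)) (hΦ.bijective_fderiv z hz))
    obtain ⟨T, X₁, X₀, U₁, U₀, hb, h₁, h₀, hne, hform, hrel⟩ :=
      exists_affine_form hε hΩ hΦ.smooth hΦ.bijective_fderiv fun z hz => ⟨_, _, hn z hz⟩
    refine ⟨T, X₁, X₀, U₁, U₀, hb, (isFibreParam_iff hD h₁ h₀ hne).2 ?_, hform, ?_⟩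
    -- The source drift does not depend on `u`, so the combined residual is affine in `u` on an open
    -- fibre and both coefficients vanish.
    · exact eq_zero_of_affine_eq_zero hΩ.isOpen
        (f := fun y => fibreResidual ε (B y) U₁ U₁ y) (g := fun y => fibreResidual ε (B y) U₁ U₀ y)
        fun z hz => (hrel z hz _ _ (hn z hz)).2
    · rintro t x ⟨z, hz, hzt⟩
      have e1 := (hrel z hz _ _ (hn z hz)).1
      rw [hform z hz] at e1
      simp only [tx, Prod.mk.injEq] at hzt
      obtain ⟨rfl, rfl⟩ := hzt
      exact e1
  · rintro ⟨T, X₁, X₀, U₁, U₀, hb, hf, hform, hB⟩ j hj - heq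
    have hres := (isFibreParam_iff hD hf.smooth_U₁ hf.smooth_U₀ hf.U₁_ne_zero).1 hf
      (jetTX j) ⟨_, hj, rfl⟩
    have key := prolong_equation_of_form hε hΩ.isOpen hb hf.smooth_U₁ hf.smooth_U₀ hf.U₁_ne_zero
      hform hj hres.1 hres.2 heq
    show prT Φ j.1 = ε * prXX Φ j + B' (tx (Φ j.1.1)) * prX Φ j.1
    rw [hform _ hj, key]
    have := hB j.1.1.1 j.1.1.2.1 ⟨_, hj, rfl⟩
    rw [show tx (affineMap T X₁ X₀ U₁ U₀ j.1.1) =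
      (T j.1.1.1, X₁ j.1.1.1 * j.1.1.2.1 + X₀ j.1.1.1) from rfl, this]
    rfl

/-! ### Inverting the base transformation -/

theorem bijective_of_ker_eq_zero {E : Type*} [NormedAddCommGroup E] [NormedSpace ℝ E]
    [FiniteDimensional ℝ E] {L : E →L[ℝ] E} (h : ∀ v, L v = 0 → v = 0) :
    Function.Bijective L := by
  have hi : Function.Injective (L : E →ₗ[ℝ] E) := (injective_iff_map_eq_zero _).2 h
  exact ⟨hi, LinearMap.injective_iff_surjective.1 hi⟩

/-- A function on the domain of a point transformation is carried to a smooth function on the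
image. -/
theorem IsPointTransformation.exists_pushforward {E : Type*} [NormedAddCommGroup E]
    [NormedSpace ℝ E] [CompleteSpace E] {f : E → E} {D : Set E} (hf : IsPointTransformation f D)
    {F : E → ℝ} (hF : ContDiffOn ℝ ∞ F D) :
    ∃ F' : E → ℝ, ContDiffOn ℝ ∞ F' (f '' D) ∧ ∀ y ∈ D, F' (f y) = F y := by
  classical
  rcases D.eq_empty_or_nonempty with rfl | ⟨y₀, hy₀⟩
  · exact ⟨fun _ => 0, contDiffOn_const, by simp⟩
  have : Nonempty E := ⟨y₀⟩
  set g := Function.invFunOn f D with hg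
  have hleft : ∀ y ∈ D, g (f y) = y := fun y hy => hf.injOn.leftInvOn_invFunOn hy
  refine ⟨fun w => F (g w), ?_, fun y hy => congrArg F (hleft y hy)⟩
  rintro _ ⟨y, hy, rfl⟩
  refine ContDiffAt.contDiffWithinAt ?_
  have hs : ContDiffAt ℝ ∞ f y := hf.smooth.contDiffAt (hf.isOpen.mem_nhds hy)
  have hb := hf.bijective_fderiv y hy
  let e : E ≃L[ℝ] E := ContinuousLinearEquiv.ofBijective (fderiv ℝ f y)
    (LinearMap.ker_eq_bot.2 hb.1) (LinearMap.range_eq_top.2 hb.2)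
  have he : HasFDerivAt f (e : E →L[ℝ] E) y := by
    have : (e : E →L[ℝ] E) = fderiv ℝ f y := by ext v; rfl
    rw [this]
    exact (hs.differentiableAt (by simp)).hasFDerivAt
  have hn : (∞ : WithTop ℕ∞) ≠ 0 := by simp
  have hinv := hs.to_localInverse he hn
  have hst : HasStrictFDerivAt f (e : E →L[ℝ] E) y := hs.hasStrictFDerivAt' he hn
  have hself : hs.localInverse he hn (f y) = y := hst.localInverse_apply_image
  -- The inverse chosen set-theoretically on `f '' D` agrees near `f y` with the smooth local
  -- inverse, because `f` is injective on `D`.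
  have hev : g =ᶠ[nhds (f y)] hs.localInverse he hn := by
    have hr : ∀ᶠ w in nhds (f y), f (hs.localInverse he hn w) = w :=
      hst.eventually_right_inverse
    have hm : ∀ᶠ w in nhds (f y), hs.localInverse he hn w ∈ D :=
      hinv.continuousAt.eventually (by rw [hself]; exact hf.isOpen.mem_nhds hy)
    filter_upwards [hr, hm] with w h1 h2
    conv_lhs => rw [← h1]
    exact hleft _ h2
  have hgs : ContDiffAt ℝ ∞ g (f y) := hinv.congr_of_eventuallyEq hev
  have hFs : ContDiffAt ℝ ∞ F (g (f y)) := by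
    rw [hleft y hy]; exact hF.contDiffAt (hf.isOpen.mem_nhds hy)
  exact hFs.comp (f y) hgs

theorem IsPointTransformation.mono {E : Type*} [NormedAddCommGroup E] [NormedSpace ℝ E]
    {f : E → E} {D D' : Set E} (hf : IsPointTransformation f D) (hD' : IsOpen D') (h : D' ⊆ D) :
    IsPointTransformation f D' :=
  ⟨hD', hf.smooth.mono h, hf.injOn.mono h, fun z hz => hf.bijective_fderiv z (h hz)⟩

/-- The transformation `t̃ = T(t)`, `x̃ = X¹(t) x + X⁰(t)` of the `(t, x)`-plane. -/
def baseMap (T X₁ X₀ : ℝ → ℝ) (y : ℝ × ℝ) : ℝ × ℝ := (T y.1, X₁ y.1 * y.2 + X₀ y.1)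

/-- `T_t` is a nonzero square, hence positive on an interval; without connectedness `T` could take a
value twice. -/
theorem IsBaseParam.injOn_T {I : Set ℝ} {T X₁ X₀ : ℝ → ℝ} (hb : IsBaseParam I T X₁ X₀)
    (hI : IsPreconnected I) : InjOn T I := by
  refine (strictMonoOn_of_deriv_pos hI.ordConnected.convex hb.smooth_T.continuousOn
    fun t ht => ?_).injOn
  have ht' := interior_subset ht
  rw [hb.deriv_T t ht']
  have := hb.X₁_ne_zero t ht'
  positivity

theorem IsBaseParam.injOn_baseMap {Ω : Set Pt} {T X₁ X₀ : ℝ → ℝ}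
    (hb : IsBaseParam (Prod.fst '' Ω) T X₁ X₀) (hI : IsPreconnected (Prod.fst '' Ω)) :
    InjOn (baseMap T X₁ X₀) (tx '' Ω) := by
  rintro _ ⟨z, hz, rfl⟩ _ ⟨w, hw, rfl⟩ h
  simp only [baseMap, tx, Prod.mk.injEq] at h ⊢
  have h1 := hb.injOn_T hI ⟨z, hz, rfl⟩ ⟨w, hw, rfl⟩ h.1
  refine ⟨h1, ?_⟩
  have h2 := h.2
  rw [← h1] at h2
  exact mul_left_cancel₀ (hb.X₁_ne_zero _ ⟨z, hz, rfl⟩) (add_right_cancel h2)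

theorem IsBaseParam.isPointTransformation {Ω : Set Pt} (hΩ : IsOpen Ω) {T X₁ X₀ : ℝ → ℝ}
    (hb : IsBaseParam (Prod.fst '' Ω) T X₁ X₀) (hI : IsPreconnected (Prod.fst '' Ω)) :
    IsPointTransformation (baseMap T X₁ X₀) (tx '' Ω) := by
  have hD := isOpen_tx_image hΩ
  have hIo := isOpen_fst_image hΩ
  have s1 : ContDiffOn ℝ ∞ (fun y : ℝ × ℝ => X₁ y.1 * y.2 + X₀ y.1) (tx '' Ω) :=
    ((contDiffOn_comp_fst hb.smooth_X₁).mul contDiffOn_snd).add (contDiffOn_comp_fst hb.smooth_X₀)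
  have sT := contDiffOn_comp_fst hb.smooth_T
  refine ⟨hD, sT.prodMk s1, hb.injOn_baseMap hI,
    fun y hy => bijective_of_ker_eq_zero fun v hv => ?_⟩
  have hy1 : y.1 ∈ Prod.fst '' Ω := by obtain ⟨z, hz, rfl⟩ := hy; exact ⟨z, hz, rfl⟩
  have e1 := (differentiableAt_of_contDiffOn sT hD hy).hasFDerivAt
  have e2 := (differentiableAt_of_contDiffOn s1 hD hy).hasFDerivAt
  have e3 : HasFDerivAt (baseMap T X₁ X₀) _ y := e1.prodMk e2
  rw [e3.fderiv, ContinuousLinearMap.prod_apply,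
    fderiv_comp_fst (differentiableAt_of_contDiffOn hb.smooth_T hIo hy1),
    fderiv_affine_x (differentiableAt_of_contDiffOn hb.smooth_X₁ hIo hy1)
      (differentiableAt_of_contDiffOn hb.smooth_X₀ hIo hy1), hb.deriv_T _ hy1] at hv
  have hv' := Prod.mk.inj hv
  have n1 := hb.X₁_ne_zero _ hy1
  have v1 : v.1 = 0 := by simpa [n1] using hv'.1
  have v2 : v.2 = 0 := by simpa [n1, v1] using hv'.2
  exact Prod.ext v1 v2

/-- The map is triangular: `t`, then `x`, then `u` can be recovered. The kernel of the derivative is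
killed in the same order. -/
theorem isPointTransformation_affineMap {Ω : Set Pt} (hΩ : IsFibredDomain Ω) {T X₁ X₀ : ℝ → ℝ}
    {U₁ U₀ : ℝ × ℝ → ℝ} (hb : IsBaseParam (Prod.fst '' Ω) T X₁ X₀)
    (h₁ : ContDiffOn ℝ ∞ U₁ (tx '' Ω)) (h₀ : ContDiffOn ℝ ∞ U₀ (tx '' Ω))
    (hne : ∀ y ∈ tx '' Ω, U₁ y ≠ 0) :
    IsPointTransformation (affineMap T X₁ X₀ U₁ U₀) Ω := by
  have hs := contDiffOn_affineMap hb h₁ h₀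
  refine ⟨hΩ.isOpen, hs, ?_, fun z hz => bijective_of_ker_eq_zero fun v hv => ?_⟩
  · intro z hz w hw h
    have h1 : T z.1 = T w.1 := congrArg Prod.fst h
    have h2 : X₁ z.1 * z.2.1 + X₀ z.1 = X₁ w.1 * w.2.1 + X₀ w.1 := congrArg (fun z => z.2.1) h
    have h3 : U₁ (tx z) * z.2.2 + U₀ (tx z) = U₁ (tx w) * w.2.2 + U₀ (tx w) :=
      congrArg (fun z => z.2.2) h
    have h4 : tx z = tx w := hb.injOn_baseMap hΩ.preconnected_t ⟨z, hz, rfl⟩ ⟨w, hw, rfl⟩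
      (Prod.ext h1 h2)
    rw [← h4] at h3
    have h5 := mul_left_cancel₀ (hne _ ⟨z, hz, rfl⟩) (add_right_cancel h3)
    have h6 := Prod.mk.inj h4
    exact Prod.ext h6.1 (Prod.ext h6.2 h5)
  · set Φ := affineMap T X₁ X₀ U₁ U₀
    have pT := pd_compT_of_form (Φ := Φ) hΩ.isOpen hb (fun _ _ => rfl) hz
    have pX := pd_compX_of_form (Φ := Φ) hΩ.isOpen hb (fun _ _ => rfl) hz
    have pU := pd_compU_of_form (Φ := Φ) hΩ.isOpen h₁ h₀ (fun _ _ => rfl) hz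
    rw [fderiv_apply_eq_comp (differentiableAt_of_contDiffOn hs hΩ.isOpen hz)] at hv
    obtain ⟨a, b, c⟩ := v
    simp only [fderiv_pt_apply, pT, pX, pU] at hv
    have n1 := hb.X₁_ne_zero _ ⟨z, hz, rfl⟩
    have n2 := hne _ ⟨z, hz, rfl⟩
    have hv1 := Prod.mk.inj hv
    have hv2 := Prod.mk.inj hv1.2
    have ha : a = 0 := by simpa [n1] using hv1.1
    have hbb : b = 0 := by simpa [n1, ha] using hv2.1
    have hcc : c = 0 := by simpa [n2, ha, hbb] using hv2.2
    rw [ha, hbb, hcc]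
    rfl

theorem contDiffOn_deriv_comp_fst {Ω : Set Pt} (hΩ : IsOpen Ω) {h : ℝ → ℝ}
    (hh : ContDiffOn ℝ ∞ h (Prod.fst '' Ω)) :
    ContDiffOn ℝ ∞ (fun y : ℝ × ℝ => deriv h y.1) (tx '' Ω) :=
  contDiffOn_comp_fst (hh.deriv_of_isOpen (isOpen_fst_image hΩ) (by simp))

/-- Smoothness of the transformed drift as a function of the original variables. -/
theorem contDiffOn_transformed_drift {Ω : Set Pt} (hΩ : IsOpen Ω) {T X₁ X₀ : ℝ → ℝ}
    (hb : IsBaseParam (Prod.fst '' Ω) T X₁ X₀) {D : Set (ℝ × ℝ)} (hD : D ⊆ tx '' Ω)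
    {B : ℝ × ℝ → ℝ} (hB : ContDiffOn ℝ ∞ B D) :
    ContDiffOn ℝ ∞ (fun y : ℝ × ℝ => 1 / X₁ y.1 * B y -
      (deriv X₁ y.1 * y.2 + deriv X₀ y.1) / X₁ y.1 ^ 2) D := by
  have hne : ∀ y ∈ D, X₁ y.1 ≠ 0 := by
    intro y hy
    obtain ⟨z, hz, rfl⟩ := hD hy
    exact hb.X₁_ne_zero _ ⟨z, hz, rfl⟩
  have s1 := (contDiffOn_comp_fst hb.smooth_X₁).mono hD
  have d1 := (contDiffOn_deriv_comp_fst hΩ hb.smooth_X₁).mono hD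
  have d0 := (contDiffOn_deriv_comp_fst hΩ hb.smooth_X₀).mono hD
  exact ((contDiffOn_const.div s1 hne).mul hB).sub
    (((d1.mul contDiffOn_snd).add d0).div (s1.pow 2) fun y hy => pow_ne_zero 2 (hne y hy))

theorem exists_isAdmissible_affineMap {ε : ℝ} (hε : ε ^ 2 = 1) {Ω : Set Pt} {B : ℝ × ℝ → ℝ}
    {T X₁ X₀ : ℝ → ℝ} {U₁ U₀ : ℝ × ℝ → ℝ} (hΩ : IsFibredDomain Ω)
    (hB : ContDiffOn ℝ ∞ B (tx '' Ω)) (hb : IsBaseParam (Prod.fst '' Ω) T X₁ X₀)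
    (hf : IsFibreParam ε B (tx '' Ω) U₁ U₀) :
    ∃ B' : ℝ × ℝ → ℝ, IsAdmissible ε Ω B (affineMap T X₁ X₀ U₁ U₀) B' := by
  have hD := isOpen_tx_image hΩ.isOpen
  have hP := isPointTransformation_affineMap hΩ hb hf.smooth_U₁ hf.smooth_U₀ hf.U₁_ne_zero
  have hbase := hb.isPointTransformation hΩ.isOpen hΩ.preconnected_t
  obtain ⟨B', hB's, hB'⟩ := hbase.exists_pushforward
    (contDiffOn_transformed_drift hΩ.isOpen hb Subset.rfl
      (B := fun y => B y - 2 * ε * (fderiv ℝ U₁ y (0, 1) / U₁ y))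
      (hB.sub (contDiffOn_const.mul
        ((contDiffOn_fderiv_apply hf.smooth_U₁ hD _).div hf.smooth_U₁ hf.U₁_ne_zero))))
  refine ⟨B', hP, hB, ?_, (connects_iff hε hΩ hP).2
    ⟨T, X₁, X₀, U₁, U₀, hb, hf, fun _ _ => rfl, fun t x htx => hB' (t, x) htx⟩⟩
  have : tx '' (affineMap T X₁ X₀ U₁ U₀ '' Ω) = baseMap T X₁ X₀ '' (tx '' Ω) := by
    rw [image_image, image_image]; rfl
  rw [this]
  exact hB's

/-! ### Contact transformations of the extended jet space -/

/-- The projection of the extended jet space to the space of `(t, x, u)` as a linear map. -/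
noncomputable def extPtL : ExtJet →L[ℝ] Pt :=
  (ContinuousLinearMap.fst ℝ Pt (ℝ × ℝ)).comp
    ((ContinuousLinearMap.fst ℝ Jet1 (ℝ × ℝ × ℝ)).comp (ContinuousLinearMap.fst ℝ Jet2 ℝ))

/-- The points of the extended jet space over `z` with the remaining coordinates of `e`. -/
def replacePt (e : ExtJet) (z : Pt) : ExtJet := (((z, e.1.1.2), e.1.2), e.2)

theorem contDiff_replacePt (e : ExtJet) : ContDiff ℝ ∞ (replacePt e) := by
  unfold replacePt; fun_prop

section Projection

variable {𝒯 : ExtJet → ExtJet} {W : Set ExtJet} {Φ : Pt → Pt}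

/-- Projectability provides `Φ` only as a function of points. Freezing the other jet coordinates at
those of `e` writes it locally as a composite of smooth maps. -/
theorem contDiffAt_projection (ho : IsOpen W) (hs : ContDiffOn ℝ ∞ 𝒯 W)
    (hΦ : ∀ e ∈ W, extPt (𝒯 e) = Φ (extPt e)) {e : ExtJet} (he : e ∈ W) :
    ContDiffAt ℝ ∞ Φ (extPt e) := by
  have h𝒯 : ContDiffAt ℝ ∞ 𝒯 (replacePt e (extPt e)) :=
    hs.contDiffAt (ho.mem_nhds he)
  have hc : ContDiffAt ℝ ∞ (fun z => extPtL (𝒯 (replacePt e z))) (extPt e) :=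
    extPtL.contDiff.contDiffAt.comp _ (h𝒯.comp _ (contDiff_replacePt e).contDiffAt)
  refine hc.congr_of_eventuallyEq ?_
  have hev : ∀ᶠ z in nhds (extPt e), replacePt e z ∈ W :=
    (ho.preimage (contDiff_replacePt e).continuous).mem_nhds he
  filter_upwards [hev] with z hz
  exact (hΦ _ hz).symm

theorem extPt_fderiv (ho : IsOpen W) (hs : ContDiffOn ℝ ∞ 𝒯 W)
    (hΦ : ∀ e ∈ W, extPt (𝒯 e) = Φ (extPt e)) {e : ExtJet} (he : e ∈ W) (v : ExtJet) :
    extPt (fderiv ℝ 𝒯 e v) = fderiv ℝ Φ (extPt e) (extPt v) := by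
  have h1 := extPtL.hasFDerivAt.comp e
    (differentiableAt_of_contDiffOn hs ho he).hasFDerivAt
  have h2 : HasFDerivAt (fun e => Φ (extPtL e)) _ e := HasFDerivAt.comp e (g := Φ) (f := extPtL)
    ((contDiffAt_projection ho hs hΦ he).differentiableAt (by simp)).hasFDerivAt extPtL.hasFDerivAt
  have h3 : (extPtL ∘ 𝒯) =ᶠ[nhds e] fun e => Φ (extPtL e) := by
    filter_upwards [ho.mem_nhds he] with w hw using hΦ w hw
  have h4 := h1.unique (h2.congr_of_eventuallyEq h3)
  exact congrArg (fun L => L v) h4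

/-- Surjectivity descends to the quotient space `(t, x, u)`, and there equality of dimensions gives
injectivity. -/
theorem bijective_fderiv_projection (hp : IsPointTransformation 𝒯 W)
    (hΦ : ∀ e ∈ W, extPt (𝒯 e) = Φ (extPt e)) {e : ExtJet} (he : e ∈ W) :
    Function.Bijective (fderiv ℝ Φ (extPt e)) := by
  have hs : Function.Surjective (fderiv ℝ Φ (extPt e) : Pt →ₗ[ℝ] Pt) := by
    intro w
    obtain ⟨v, hv⟩ := (hp.bijective_fderiv e he).2 (((w, 0), 0), 0)
    refine ⟨extPt v, ?_⟩
    have := extPt_fderiv hp.isOpen hp.smooth hΦ he v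
    rw [hv] at this
    exact this.symm
  exact ⟨LinearMap.injective_iff_surjective.2 hs, hs⟩

/-- The contact condition on the derivatives of `ũ`. -/
theorem contact_compU (hp : IsPointTransformation 𝒯 W)
    (hΦ : ∀ e ∈ W, extPt (𝒯 e) = Φ (extPt e))
    (hc : ∀ e ∈ W, ∀ v : ExtJet, v.1 ∈ cartan e.1 → (fderiv ℝ 𝒯 e v).1 ∈ cartan (𝒯 e).1)
    {e : ExtJet} (he : e ∈ W) (α γ : ℝ) :
    α * totT (compU Φ) e.1.1 + γ * totX (compU Φ) e.1.1 =
      (𝒯 e).1.1.2.1 * (α * totT (compT Φ) e.1.1 + γ * totX (compT Φ) e.1.1) +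
      (𝒯 e).1.1.2.2 * (α * totT (compX Φ) e.1.1 + γ * totX (compX Φ) e.1.1) := by
  -- The Cartan vector `α D_t + γ D_x` at `e`, with zero components along `u_tt, u_tx, u_xx, B`.
  set v : ExtJet := ((((α, γ, α * e.1.1.2.1 + γ * e.1.1.2.2),
    (α * e.1.2.1 + γ * e.1.2.2.1, α * e.1.2.2.1 + γ * e.1.2.2.2)), (0, 0, 0)), 0) with hv
  have h1 := (hc e he v ⟨by simp [hv]; ring, by simp [hv]; ring, by simp [hv]; ring⟩).1
  have h2 := extPt_fderiv hp.isOpen hp.smooth hΦ he v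
  have hs := contDiffAt_projection hp.isOpen hp.smooth hΦ he
  rw [fderiv_apply_eq_comp (hs.differentiableAt (by simp))] at h2
  simp only [extPt, hv, fderiv_pt_apply] at h2
  rw [h2] at h1
  simp only at h1
  simp only [totT_eq, totX_eq]
  linear_combination h1

/-- In the frame `D_t, D_x, ∂_u`, the contact condition says that the row of `U` minus `ũ_t̃` times
that of `T` minus `ũ_x̃` times that of `X` vanishes on `D_t, D_x`. Hence the Jacobian determinant is
the total Jacobian times one further factor. -/
theorem totJac_ne_zero_of_contact (hp : IsPointTransformation 𝒯 W)
    (hΦ : ∀ e ∈ W, extPt (𝒯 e) = Φ (extPt e))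
    (hc : ∀ e ∈ W, ∀ v : ExtJet, v.1 ∈ cartan e.1 → (fderiv ℝ 𝒯 e v).1 ∈ cartan (𝒯 e).1)
    {e : ExtJet} (he : e ∈ W) : totJac Φ e.1.1 ≠ 0 := by
  intro h0
  have hs := contDiffAt_projection hp.isOpen hp.smooth hΦ he
  have hdet := jacDet_ne_zero (hs.differentiableAt (by simp))
    (bijective_fderiv_projection hp hΦ he)
  have h1 := contact_compU hp hΦ hc he 1 0
  have h2 := contact_compU hp hΦ hc he 0 1
  simp only [one_mul, zero_mul, add_zero, zero_add] at h1 h2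
  apply hdet
  simp only [totJac, totT_eq, totX_eq] at h0 h1 h2
  rw [jacDet]
  simp only [extPt]
  linear_combination
    (pdU (compU Φ) e.1.1.1 - (𝒯 e).1.1.2.1 * pdU (compT Φ) e.1.1.1 -
      (𝒯 e).1.1.2.2 * pdU (compX Φ) e.1.1.1) * h0 +
    ((pdX (compT Φ) e.1.1.1 + e.1.1.2.2 * pdU (compT Φ) e.1.1.1) * pdU (compX Φ) e.1.1.1 -
      pdU (compT Φ) e.1.1.1 * (pdX (compX Φ) e.1.1.1 + e.1.1.2.2 * pdU (compX Φ) e.1.1.1)) * h1 -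
    ((pdT (compT Φ) e.1.1.1 + e.1.1.2.1 * pdU (compT Φ) e.1.1.1) * pdU (compX Φ) e.1.1.1 -
      pdU (compT Φ) e.1.1.1 * (pdT (compX Φ) e.1.1.1 + e.1.1.2.1 * pdU (compX Φ) e.1.1.1)) * h2

/-- The first-order part of a contact transformation is the prolongation of its projection. -/
theorem contact_first_order (hp : IsPointTransformation 𝒯 W)
    (hΦ : ∀ e ∈ W, extPt (𝒯 e) = Φ (extPt e))
    (hc : ∀ e ∈ W, ∀ v : ExtJet, v.1 ∈ cartan e.1 → (fderiv ℝ 𝒯 e v).1 ∈ cartan (𝒯 e).1)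
    {e : ExtJet} (he : e ∈ W) :
    (𝒯 e).1.1.2.1 = prT Φ e.1.1 ∧ (𝒯 e).1.1.2.2 = prX Φ e.1.1 := by
  have hJ := totJac_ne_zero_of_contact hp hΦ hc he
  have h1 := contact_compU hp hΦ hc he 1 0
  have h2 := contact_compU hp hΦ hc he 0 1
  simp only [one_mul, zero_mul, add_zero, zero_add] at h1 h2
  rw [prT, prX, eq_div_iff hJ, eq_div_iff hJ, h1, h2, totJac]
  constructor <;> ring

/-- The `ũ_x̃x̃`-component of a contact transformation is the prolongation of its projection. -/
theorem contact_prXX (hp : IsPointTransformation 𝒯 W)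
    (hΦ : ∀ e ∈ W, extPt (𝒯 e) = Φ (extPt e))
    (hc : ∀ e ∈ W, ∀ v : ExtJet, v.1 ∈ cartan e.1 → (fderiv ℝ 𝒯 e v).1 ∈ cartan (𝒯 e).1)
    {e : ExtJet} (he : e ∈ W) : (𝒯 e).1.2.2.2 = prXX Φ e.1 := by
  have hJ := totJac_ne_zero_of_contact hp hΦ hc he
  have hs := contDiffAt_projection hp.isOpen hp.smooth hΦ he
  have hd : ∀ v : ExtJet, (fderiv ℝ 𝒯 e v).1.1.2.2 = fderiv ℝ (prX Φ) e.1.1 v.1.1 := by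
    intro v
    have h1 := (differentiableAt_of_contDiffOn hp.smooth hp.isOpen he).hasFDerivAt
    have h2 := h1.fst.fst.snd.snd
    have h3 : HasFDerivAt (fun e : ExtJet => prX Φ e.1.1) _ e :=
      HasFDerivAt.comp e (g := prX Φ) (f := fun e : ExtJet => e.1.1)
        ((contDiffAt_prX (j := e.1.1) hs hJ).differentiableAt (by simp)).hasFDerivAt
        (hasFDerivAt_id (𝕜 := ℝ) e).fst.fst
    have h4 : (fun e => (𝒯 e).1.1.2.2) =ᶠ[nhds e] fun e => prX Φ e.1.1 := by
      filter_upwards [hp.isOpen.mem_nhds he] with w hw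
      exact (contact_first_order hp hΦ hc hw).2
    have h5 := h2.unique (h3.congr_of_eventuallyEq h4)
    exact congrArg (fun L => L v) h5
  -- The third contact form evaluated on `α D_t + γ D_x`. The cases `D_t` and `D_x` form a linear
  -- system for `ũ_t̃x̃, ũ_x̃x̃`, solved by Cramer's rule.
  have key : ∀ α γ : ℝ, α * totT1 (prX Φ) e.1 + γ * totX1 (prX Φ) e.1 =
      (𝒯 e).1.2.2.1 * (α * totT (compT Φ) e.1.1 + γ * totX (compT Φ) e.1.1) +
      (𝒯 e).1.2.2.2 * (α * totT (compX Φ) e.1.1 + γ * totX (compX Φ) e.1.1) := by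
    intro α γ
    set v : ExtJet := ((((α, γ, α * e.1.1.2.1 + γ * e.1.1.2.2),
      (α * e.1.2.1 + γ * e.1.2.2.1, α * e.1.2.2.1 + γ * e.1.2.2.2)), (0, 0, 0)), 0) with hv
    have h1 := (hc e he v ⟨by simp [hv]; ring, by simp [hv]; ring, by simp [hv]; ring⟩).2.2
    have h2 := extPt_fderiv hp.isOpen hp.smooth hΦ he v
    rw [fderiv_apply_eq_comp (hs.differentiableAt (by simp))] at h2
    simp only [extPt, hv, fderiv_pt_apply] at h2
    rw [h2, hd] at h1
    have h6 : v.1.1 = α • ((1, 0, e.1.1.2.1), (e.1.2.1, e.1.2.2.1)) +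
        γ • ((0, 1, e.1.1.2.2), (e.1.2.2.1, e.1.2.2.2)) := by
      simp [hv, Prod.ext_iff]
    rw [h6, map_add, map_smul, map_smul] at h1
    simp only [smul_eq_mul] at h1
    simp only [totT_eq, totX_eq, totT1, totX1]
    linear_combination h1
  have k1 := key 1 0
  have k2 := key 0 1
  simp only [one_mul, zero_mul, add_zero, zero_add] at k1 k2
  rw [prXX, eq_div_iff hJ, k1, k2, totJac]
  ring

end Projection

/-! ### The equivalence group -/

theorem exists_eq_const {Ω : Set Pt} (hΩ : IsFibredDomain Ω) {g : ℝ × ℝ → ℝ}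
    (hg : ContDiffOn ℝ ∞ g (tx '' Ω)) (ht : ∀ y ∈ tx '' Ω, fderiv ℝ g y (1, 0) = 0)
    (hx : ∀ y ∈ tx '' Ω, fderiv ℝ g y (0, 1) = 0) : ∃ c, ∀ y ∈ tx '' Ω, g y = c := by
  have hD := isOpen_tx_image hΩ.isOpen
  have hI := isOpen_fst_image hΩ.isOpen
  obtain ⟨h, hh, hgh⟩ := exists_eq_comp_fst hΩ hg hx
  have hd : ∀ t ∈ Prod.fst '' Ω, deriv h t = 0 := by
    rintro _ ⟨z, hz, rfl⟩
    have hy : tx z ∈ tx '' Ω := ⟨z, hz, rfl⟩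
    have h1 := ht _ hy
    have h2 : g =ᶠ[nhds (tx z)] fun y => h y.1 := by
      filter_upwards [hD.mem_nhds hy] with w hw using hgh w hw
    rw [h2.fderiv_eq, fderiv_comp_fst (differentiableAt_of_contDiffOn hh hI ⟨z, hz, rfl⟩)] at h1
    simpa [tx] using h1
  rcases Ω.eq_empty_or_nonempty with rfl | ⟨z₀, hz₀⟩
  · exact ⟨0, by simp⟩
  refine ⟨h z₀.1, ?_⟩
  rintro _ ⟨z, hz, rfl⟩
  rw [hgh _ ⟨z, hz, rfl⟩]
  exact hI.is_const_of_deriv_eq_zero hΩ.preconnected_t (hh.differentiableOn (by simp))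
    (fun t ht => hd t ht) ⟨z, hz, rfl⟩ ⟨z₀, hz₀, rfl⟩

section EquivalenceForm

variable {ε : ℝ} {W : Set ExtJet} {𝒯 : ExtJet → ExtJet} {Φ : Pt → Pt}

/-- The constant drift `b` suffices as a test. All jets used lie over one point `z`, so the
transformed drift is evaluated at a single point, where it equals the `B`-component of `𝒯 e`. -/
theorem IsEquivalenceTransformation.connectsNear_of_eq (hε : ε ^ 2 = 1)
    (h : IsEquivalenceTransformation ε W 𝒯) (hΦ : ∀ e ∈ W, extPt (𝒯 e) = Φ (extPt e))
    {e : ExtJet} (he : e ∈ W) (heq : e.1.1.2.1 = ε * e.1.2.2.2 + e.2 * e.1.1.2.2) :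
    ConnectsNear ε e.2 (𝒯 e).2 Φ (extPt e) := by
  obtain ⟨⟨⟨z, p₀, q₀⟩, m₀, n₀, s₀⟩, b⟩ := e
  have hp := h.contactTransformation.pointTransformation
  have hc := h.contactTransformation.contact
  simp only at heq
  have hs₀ : s₀ = ε * (p₀ - b * q₀) := by linear_combination -ε * heq - s₀ * hε
  subst hs₀
  set π : ℝ × ℝ × ℝ × ℝ → ExtJet := fun w =>
    (((z, (w.1, w.2.1)), (w.2.2.1, w.2.2.2, ε * (w.1 - b * w.2.1))), b) with hπ
  have hcont : Continuous π := by fun_prop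
  have hev : ∀ᶠ w in nhds (p₀, q₀, m₀, n₀), π w ∈ W := (hp.isOpen.preimage hcont).mem_nhds he
  obtain ⟨r, hr, hr'⟩ := Metric.eventually_nhds_iff.1 hev
  obtain ⟨θ', -, hθ'⟩ := h.preservesClass univ (fun _ => b) isOpen_univ contDiffOn_const
  refine ⟨p₀, q₀, m₀, n₀, r, hr, fun p q m n h1 h2 h3 h4 => ?_⟩
  have hw : (((z, (p, q)), (m, n, ε * (p - b * q))), b) ∈ W :=
    hr' (y := (p, q, m, n)) (by
      simp only [Prod.dist_eq, Real.dist_eq]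
      exact max_lt h1 (max_lt h2 (max_lt h3 h4)))
  refine ⟨totJac_ne_zero_of_contact hp hΦ hc hw, ?_⟩
  have f1 := contact_first_order hp hΦ hc hw
  have f2 := contact_prXX hp hΦ hc hw
  have k0 := (hθ' _ (⟨mem_univ _, he⟩ : _ ∈ jetsOf W univ fun _ => b)).1
  have k1 := (hθ' ((z, (p, q)), (m, n, ε * (p - b * q)))
    (⟨mem_univ _, hw⟩ : _ ∈ jetsOf W univ fun _ => b)).2 (by
      show p = ε * (ε * (p - b * q)) + b * q
      linear_combination -(p - b * q) * hε)
  simp only [equationSet, mem_ofPred_eq] at k1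
  rw [f1.1, f1.2, f2] at k1
  have t1 : jetTX (𝒯 (((z, (p, q)), (m, n, ε * (p - b * q))), b)).1 = tx (Φ z) :=
    congrArg tx (hΦ _ hw)
  have t0 : jetTX (𝒯 (((z, (p₀, q₀)), (m₀, n₀, ε * (p₀ - b * q₀))), b)).1 = tx (Φ z) :=
    congrArg tx (hΦ _ he)
  rw [t1] at k1
  rw [t0] at k0
  rw [k0]
  exact k1

/-- `meets` supplies a jet on the equation with the same `(t, x, u)` and `b`. A constant drift goes
to a function of `(t̃, x̃)`, so the `B`-component of `𝒯` agrees at the two jets. -/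
theorem IsEquivalenceTransformation.connectsNear (hε : ε ^ 2 = 1) (hW : IsExtDomain ε W)
    (h : IsEquivalenceTransformation ε W 𝒯) (hΦ : ∀ e ∈ W, extPt (𝒯 e) = Φ (extPt e))
    {e : ExtJet} (he : e ∈ W) : ConnectsNear ε e.2 (𝒯 e).2 Φ (extPt e) := by
  obtain ⟨j, hj, hjW, hjeq⟩ := hW.meets e he
  have k := h.connectsNear_of_eq hε hΦ hjW hjeq
  obtain ⟨θ', -, hθ'⟩ := h.preservesClass univ (fun _ => e.2) isOpen_univ contDiffOn_const
  have k0 := (hθ' _ (⟨mem_univ _, he⟩ : e.1 ∈ jetsOf W univ fun _ => e.2)).1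
  have k1 := (hθ' _ (⟨mem_univ _, hjW⟩ : j ∈ jetsOf W univ fun _ => e.2)).1
  have hz : extPt (j, e.2) = extPt e := hj
  have t0 : jetTX (𝒯 (e.1, e.2)).1 = tx (Φ (extPt e)) := congrArg tx (hΦ _ he)
  have t1 : jetTX (𝒯 (j, e.2)).1 = tx (Φ (extPt e)) := by
    rw [← hz]; exact congrArg tx (hΦ _ hjW)
  rw [t0] at k0
  rw [t1] at k1
  rw [hz] at k
  have : (𝒯 e).2 = (𝒯 (j, e.2)).2 := k0.trans k1.symm
  rw [this]
  exact k

theorem fibreResidual_sub (b b' : ℝ) (U₁ V : ℝ × ℝ → ℝ) (y : ℝ × ℝ) :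
    fibreResidual ε b U₁ V y - fibreResidual ε b' U₁ V y =
      (b' - b) * (U₁ y * fderiv ℝ V y (0, 1)) := by
  simp only [fibreResidual]; ring

theorem exists_mem_drift_ne (hW : IsOpen W) {e : ExtJet} (he : e ∈ W) :
    ∃ b, b ≠ e.2 ∧ (e.1, b) ∈ W := by
  have h : ∀ᶠ b in nhds e.2, (e.1, b) ∈ W :=
    (hW.preimage (f := fun b : ℝ => (e.1, b)) (by fun_prop)).mem_nhds he
  obtain ⟨r, hr, hr'⟩ := Metric.eventually_nhds_iff.1 h
  refine ⟨e.2 + r / 2, by linarith, hr' ?_⟩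
  rw [Real.dist_eq, add_sub_cancel_left, abs_of_pos (by linarith)]
  linarith

theorem IsEquivalenceTransformation.exists_form (hε : ε ^ 2 = 1) (hW : IsExtDomain ε W)
    (h : IsEquivalenceTransformation ε W 𝒯) :
    ∃ (T X₁ X₀ : ℝ → ℝ) (c₁ c₂ : ℝ), IsBaseParam (Prod.fst '' (extPt '' W)) T X₁ X₀ ∧
      c₁ ≠ 0 ∧ HasEquivalenceForm W 𝒯 T X₁ X₀ c₁ c₂ := by
  obtain ⟨Φ, hΦ⟩ := h.contactTransformation.projectable_pt
  have hp := h.contactTransformation.pointTransformation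
  have hΩ := hW.fibred
  have hD := isOpen_tx_image hΩ.isOpen
  obtain ⟨T, X₁, X₀, U₁, U₀, hb, h₁, h₀, hne, hform, hrel⟩ :=
    exists_affine_form hε hΩ (Φ := Φ)
      (by
        rintro _ ⟨e, he, rfl⟩
        exact (contDiffAt_projection hp.isOpen hp.smooth hΦ he).contDiffWithinAt)
      (by rintro _ ⟨e, he, rfl⟩; exact bijective_fderiv_projection hp hΦ he)
      (by rintro _ ⟨e, he, rfl⟩; exact ⟨_, _, h.connectsNear hε hW hΦ he⟩)
  have hrel' := fun e (he : e ∈ W) =>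
    hrel (extPt e) ⟨e, he, rfl⟩ _ _ (h.connectsNear hε hW hΦ he)
  have hx := eq_zero_of_affine_eq_zero hΩ.isOpen (f := fun y => fderiv ℝ U₁ y (0, 1))
    (g := fun y => fderiv ℝ U₀ y (0, 1)) (by
      rintro _ ⟨e, he, rfl⟩
      -- Subtracting the residual identities for two drift values over the same point leaves only
      -- `U¹ (U¹_x u + U⁰_x)`.
      obtain ⟨b, hb', heb⟩ := exists_mem_drift_ne hW.isOpen he
      have e1 := (hrel' e he).2
      have e2 := (hrel' _ heb).2
      rw [show extPt (e.1, b) = extPt e from rfl] at e2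
      have d1 := fibreResidual_sub (ε := ε) e.2 b U₁ U₁ (tx (extPt e))
      have d0 := fibreResidual_sub (ε := ε) e.2 b U₁ U₀ (tx (extPt e))
      have e3 : (b - e.2) * U₁ (tx (extPt e)) *
          (fderiv ℝ U₁ (tx (extPt e)) (0, 1) * (extPt e).2.2 +
            fderiv ℝ U₀ (tx (extPt e)) (0, 1)) = 0 := by
        linear_combination e1 - e2 - (extPt e).2.2 * d1 - d0
      exact (mul_eq_zero.1 e3).resolve_left
        (mul_ne_zero (sub_ne_zero.2 hb') (hne _ ⟨_, ⟨e, he, rfl⟩, rfl⟩)))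
  have hxx : ∀ {V : ℝ × ℝ → ℝ}, (∀ y ∈ tx '' (extPt '' W), fderiv ℝ V y (0, 1) = 0) →
      ∀ y ∈ tx '' (extPt '' W), fderiv ℝ (fun y' => fderiv ℝ V y' (0, 1)) y (0, 1) = 0 := by
    intro V hV y hy
    have : (fun y' => fderiv ℝ V y' (0, 1)) =ᶠ[nhds y] fun _ => 0 := by
      filter_upwards [hD.mem_nhds hy] with w hw using hV w hw
    rw [this.fderiv_eq]
    simp
  have ht := eq_zero_of_affine_eq_zero hΩ.isOpen (f := fun y => fderiv ℝ U₁ y (1, 0))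
    (g := fun y => fderiv ℝ U₀ y (1, 0)) (by
      rintro _ ⟨e, he, rfl⟩
      have hy : tx (extPt e) ∈ tx '' (extPt '' W) := ⟨_, ⟨e, he, rfl⟩, rfl⟩
      have e1 := (hrel' e he).2
      simp only [fibreResidual, hxx (fun y hy => (hx y hy).1) _ hy,
        hxx (fun y hy => (hx y hy).2) _ hy, (hx _ hy).1, (hx _ hy).2] at e1
      have e2 : U₁ (tx (extPt e)) * (fderiv ℝ U₁ (tx (extPt e)) (1, 0) * (extPt e).2.2 +
            fderiv ℝ U₀ (tx (extPt e)) (1, 0)) = 0 := by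
        linear_combination e1
      exact (mul_eq_zero.1 e2).resolve_left (hne _ hy))
  obtain ⟨c₁, hc₁⟩ := exists_eq_const hΩ h₁ (fun y hy => (ht y hy).1) (fun y hy => (hx y hy).1)
  obtain ⟨c₂, hc₂⟩ := exists_eq_const hΩ h₀ (fun y hy => (ht y hy).2) (fun y hy => (hx y hy).2)
  rcases W.eq_empty_or_nonempty with rfl | ⟨e₀, he₀⟩
  -- On an empty domain `c₁` carries no information and could be zero, so a nonzero value is
  -- supplied.
  · exact ⟨T, X₁, X₀, 1, 0, hb, one_ne_zero, by simp [HasEquivalenceForm]⟩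
  refine ⟨T, X₁, X₀, c₁, c₂, hb, ?_, fun e he => ?_⟩
  · have hy : tx (extPt e₀) ∈ tx '' (extPt '' W) := ⟨_, ⟨e₀, he₀, rfl⟩, rfl⟩
    rw [← hc₁ _ hy]
    exact hne _ hy
  · have hy : tx (extPt e) ∈ tx '' (extPt '' W) := ⟨_, ⟨e, he, rfl⟩, rfl⟩
    constructor
    · rw [hΦ e he, hform _ ⟨e, he, rfl⟩, affineMap, affineMap, hc₁ _ hy, hc₂ _ hy]
    · rw [(hrel' e he).1, (hx _ hy).1]
      ring

theorem preservesClass_of_form (hε : ε ^ 2 = 1) (hW : IsExtDomain ε W)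
    (h : IsContactTransformation 𝒯 W) {T X₁ X₀ : ℝ → ℝ} {c₁ c₂ : ℝ}
    (hb : IsBaseParam (Prod.fst '' (extPt '' W)) T X₁ X₀) (hc₁ : c₁ ≠ 0)
    (hform : HasEquivalenceForm W 𝒯 T X₁ X₀ c₁ c₂) : PreservesClass ε W 𝒯 := by
  intro D θ hDo hθ
  obtain ⟨Φ, hΦ⟩ := h.projectable_pt
  have hp := h.pointTransformation
  have hΩ := hW.fibred
  have hD := isOpen_tx_image hΩ.isOpen
  have hΦf : ∀ z ∈ extPt '' W, Φ z = affineMap T X₁ X₀ (fun _ => c₁) (fun _ => c₂) z := by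
    rintro _ ⟨e, he, rfl⟩
    rw [← hΦ e he, (hform e he).1]
  -- The base map is restricted to where both the drift `θ` and the parameters are smooth. The
  -- pushforward is the new drift for every jet at once.
  obtain ⟨θ', hθ's, hθ'⟩ := ((hb.isPointTransformation hΩ.isOpen hΩ.preconnected_t).mono
    (hDo.inter hD) inter_subset_right).exists_pushforward
    (contDiffOn_transformed_drift hΩ.isOpen hb inter_subset_right (hθ.mono inter_subset_left))
  have hmem : ∀ j ∈ jetsOf W D θ, jetTX j ∈ D ∩ tx '' (extPt '' W) := fun j hj =>
    ⟨hj.1, ⟨_, ⟨_, hj.2, rfl⟩, rfl⟩⟩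
  have hbase : ∀ j ∈ jetsOf W D θ,
      jetTX (𝒯 (j, θ (jetTX j))).1 = baseMap T X₁ X₀ (jetTX j) := fun j hj =>
    congrArg tx (hform _ hj.2).1
  refine ⟨θ', hθ's.mono ?_, fun j hj => ⟨?_, fun heq => ?_⟩⟩
  · rintro _ ⟨j, hj, rfl⟩
    exact ⟨jetTX j, hmem j hj, (hbase j hj).symm⟩
  · rw [hbase j hj, hθ' _ (hmem j hj), (hform _ hj.2).2]
    rfl
  · have hjΩ : j.1.1 ∈ extPt '' W := ⟨_, hj.2, rfl⟩
    have key := prolong_equation_of_form hε hΩ.isOpen hb contDiffOn_const contDiffOn_const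
      (fun _ _ => hc₁) hΦf (b := θ (jetTX j)) hjΩ (by simp [fibreResidual])
      (by simp [fibreResidual]) heq
    have f1 := contact_first_order hp hΦ h.contact hj.2
    have f2 := contact_prXX hp hΦ h.contact hj.2
    simp only [equationSet, mem_ofPred_eq]
    rw [f1.1, f1.2, f2, key, hbase j hj, hθ' _ (hmem j hj)]
    simp [jetTX, tx]

theorem isEquivalenceTransformation_iff (hε : ε ^ 2 = 1) (hW : IsExtDomain ε W) :
    IsEquivalenceTransformation ε W 𝒯 ↔ IsContactTransformation 𝒯 W ∧
      ∃ (T X₁ X₀ : ℝ → ℝ) (c₁ c₂ : ℝ), IsBaseParam (Prod.fst '' (extPt '' W)) T X₁ X₀ ∧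
        c₁ ≠ 0 ∧ HasEquivalenceForm W 𝒯 T X₁ X₀ c₁ c₂ := by
  constructor
  · intro h
    exact ⟨h.contactTransformation, h.exists_form hε hW⟩
  · rintro ⟨h, T, X₁, X₀, c₁, c₂, hb, hc, hform⟩
    exact ⟨h, preservesClass_of_form hε hW h hb hc hform⟩

end EquivalenceForm

/-! ### Realization of the equivalence transformations -/

/-- `X_t = X¹_t x + X⁰_t` as a function on the extended jet space. -/
noncomputable def shift (X₁ X₀ : ℝ → ℝ) (e : ExtJet) : ℝ :=
  deriv X₁ (extPt e).1 * (extPt e).2.1 + deriv X₀ (extPt e).1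

/-- The component `ũ_t̃` of the prolongation, where `a = X¹` and `S = X_t`. -/
noncomputable def liftT (c a S p q : ℝ) : ℝ := c * (p * a - q * S) / a ^ 3

/-- The component `ũ_t̃x̃` of the prolongation, where `a = X¹`, `a' = X¹_t` and `S = X_t`. -/
noncomputable def liftTX (c a a' S q n s : ℝ) : ℝ := c * (n * a - q * a' - s * S) / a ^ 4

/-- The component `ũ_t̃t̃` of the prolongation, where `a = X¹`, `a' = X¹_t`, `S = X_t` and
`S' = X_tt`. -/
noncomputable def liftTT (c a a' S S' p q m n s : ℝ) : ℝ :=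
  ((c * (m * a - n * S) * a + c * (3 * q * S * a' - 2 * p * a' * a - q * S' * a)) / a ^ 4 -
    liftTX c a a' S q n s * S) / a ^ 2

/-- The transformation of the space of `(t, x, u_(2), B)` with the parameters `T`, `X¹`, `X⁰`,
`c₁`, `c₂`. -/
noncomputable def equivalenceMap (T X₁ X₀ : ℝ → ℝ) (c₁ c₂ : ℝ) (e : ExtJet) : ExtJet :=
  (((affineMap T X₁ X₀ (fun _ => c₁) (fun _ => c₂) (extPt e),
    (liftT c₁ (X₁ (extPt e).1) (shift X₁ X₀ e) e.1.1.2.1 e.1.1.2.2,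
      c₁ * e.1.1.2.2 / X₁ (extPt e).1)),
    (liftTT c₁ (X₁ (extPt e).1) (deriv X₁ (extPt e).1) (shift X₁ X₀ e)
        (shift (deriv X₁) (deriv X₀) e) e.1.1.2.1 e.1.1.2.2 e.1.2.1 e.1.2.2.1 e.1.2.2.2,
      liftTX c₁ (X₁ (extPt e).1) (deriv X₁ (extPt e).1) (shift X₁ X₀ e)
        e.1.1.2.2 e.1.2.2.1 e.1.2.2.2,
      c₁ * e.1.2.2.2 / X₁ (extPt e).1 ^ 2)),
    1 / X₁ (extPt e).1 * e.2 - shift X₁ X₀ e / X₁ (extPt e).1 ^ 2)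

section Realization

variable {W : Set ExtJet} {T X₁ X₀ : ℝ → ℝ} {c₁ c₂ : ℝ}

theorem mem_fst_image {e : ExtJet} (he : e ∈ W) : (extPt e).1 ∈ Prod.fst '' (extPt '' W) :=
  ⟨_, ⟨e, he, rfl⟩, rfl⟩

theorem contDiffOn_comp_time {h : ℝ → ℝ}
    (hh : ContDiffOn ℝ ∞ h (Prod.fst '' (extPt '' W))) :
    ContDiffOn ℝ ∞ (fun e => h (extPt e).1) W :=
  hh.comp (by unfold extPt; fun_prop) fun _ he => mem_fst_image he

theorem contDiffOn_shift (hI : IsOpen (Prod.fst '' (extPt '' W)))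
    (h₁ : ContDiffOn ℝ ∞ X₁ (Prod.fst '' (extPt '' W)))
    (h₀ : ContDiffOn ℝ ∞ X₀ (Prod.fst '' (extPt '' W))) :
    ContDiffOn ℝ ∞ (shift X₁ X₀) W :=
  ((contDiffOn_comp_time (h₁.deriv_of_isOpen hI (by simp))).mul
    (by unfold extPt; fun_prop)).add (contDiffOn_comp_time (h₀.deriv_of_isOpen hI (by simp)))

theorem contDiffOn_equivalenceMap (hI : IsOpen (Prod.fst '' (extPt '' W)))
    (hb : IsBaseParam (Prod.fst '' (extPt '' W)) T X₁ X₀) :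
    ContDiffOn ℝ ∞ (equivalenceMap T X₁ X₀ c₁ c₂) W := by
  have d₁ := hb.smooth_X₁.deriv_of_isOpen hI (m := ∞) (by simp)
  have d₀ := hb.smooth_X₀.deriv_of_isOpen hI (m := ∞) (by simp)
  have hT := contDiffOn_comp_time hb.smooth_T
  have ha := contDiffOn_comp_time hb.smooth_X₁
  have ha0 := contDiffOn_comp_time hb.smooth_X₀
  have ha' := contDiffOn_comp_time d₁
  have hS := contDiffOn_shift hI hb.smooth_X₁ hb.smooth_X₀
  have hS' := contDiffOn_shift hI d₁ d₀
  have hne : ∀ e ∈ W, X₁ (extPt e).1 ≠ 0 := fun e he => hb.X₁_ne_zero _ (mem_fst_image he)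
  have hne2 : ∀ k : ℕ, ∀ e ∈ W, X₁ (extPt e).1 ^ k ≠ 0 := fun k e he => pow_ne_zero k (hne e he)
  have hx : ContDiffOn ℝ ∞ (fun e : ExtJet => (extPt e).2.1) W := by unfold extPt; fun_prop
  have hu : ContDiffOn ℝ ∞ (fun e : ExtJet => (extPt e).2.2) W := by unfold extPt; fun_prop
  have hp : ContDiffOn ℝ ∞ (fun e : ExtJet => e.1.1.2.1) W := by fun_prop
  have hq : ContDiffOn ℝ ∞ (fun e : ExtJet => e.1.1.2.2) W := by fun_prop
  have hm : ContDiffOn ℝ ∞ (fun e : ExtJet => e.1.2.1) W := by fun_prop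
  have hn : ContDiffOn ℝ ∞ (fun e : ExtJet => e.1.2.2.1) W := by fun_prop
  have hs : ContDiffOn ℝ ∞ (fun e : ExtJet => e.1.2.2.2) W := by fun_prop
  have hB : ContDiffOn ℝ ∞ (fun e : ExtJet => e.2) W := by fun_prop
  have hTX : ContDiffOn ℝ ∞ (fun e : ExtJet => liftTX c₁ (X₁ (extPt e).1) (deriv X₁ (extPt e).1)
      (shift X₁ X₀ e) e.1.1.2.2 e.1.2.2.1 e.1.2.2.2) W := by
    unfold liftTX
    exact (contDiffOn_const.mul (((hn.mul ha).sub (hq.mul ha')).sub (hs.mul hS))).div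
      (ha.pow 4) (hne2 4)
  have hTT : ContDiffOn ℝ ∞ (fun e : ExtJet => liftTT c₁ (X₁ (extPt e).1) (deriv X₁ (extPt e).1)
      (shift X₁ X₀ e) (shift (deriv X₁) (deriv X₀) e) e.1.1.2.1 e.1.1.2.2 e.1.2.1 e.1.2.2.1
      e.1.2.2.2) W := by
    unfold liftTT
    exact (((((contDiffOn_const.mul ((hm.mul ha).sub (hn.mul hS))).mul ha).add
      (contDiffOn_const.mul (((((contDiffOn_const.mul hq).mul hS).mul ha').sub
        (((contDiffOn_const.mul hp).mul ha').mul ha)).sub ((hq.mul hS').mul ha)))).div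
      (ha.pow 4) (hne2 4)).sub (hTX.mul hS)).div (ha.pow 2) (hne2 2)
  have hTt : ContDiffOn ℝ ∞ (fun e : ExtJet => liftT c₁ (X₁ (extPt e).1) (shift X₁ X₀ e)
      e.1.1.2.1 e.1.1.2.2) W := by
    unfold liftT
    exact (contDiffOn_const.mul ((hp.mul ha).sub (hq.mul hS))).div (ha.pow 3) (hne2 3)
  have hpt : ContDiffOn ℝ ∞ (fun e : ExtJet =>
      affineMap T X₁ X₀ (fun _ => c₁) (fun _ => c₂) (extPt e)) W :=
    hT.prodMk (((ha.mul hx).add ha0).prodMk ((contDiffOn_const.mul hu).add contDiffOn_const))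
  exact (((hpt.prodMk (hTt.prodMk ((contDiffOn_const.mul hq).div ha hne))).prodMk
    (hTT.prodMk (hTX.prodMk ((contDiffOn_const.mul hs).div (ha.pow 2) (hne2 2)))))).prodMk
    (((contDiffOn_const.div ha hne).mul hB).sub (hS.div (ha.pow 2) (hne2 2)))

/-- The fibre components of `equivalenceMap` determine the fibre coordinates. -/
theorem fibre_eq_of_lift_eq {c a a' S S' p q m n s p' q' m' n' s' : ℝ} (hc : c ≠ 0) (ha : a ≠ 0)
    (h1 : liftT c a S p q = liftT c a S p' q') (h2 : c * q / a = c * q' / a)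
    (h3 : liftTT c a a' S S' p q m n s = liftTT c a a' S S' p' q' m' n' s')
    (h4 : liftTX c a a' S q n s = liftTX c a a' S q' n' s')
    (h5 : c * s / a ^ 2 = c * s' / a ^ 2) :
    p = p' ∧ q = q' ∧ m = m' ∧ n = n' ∧ s = s' := by
  -- The lift is triangular in the order `q, s`, then `p, n`, then `m`.
  have hq : q = q' := by field_simp at h2; exact h2
  have hs : s = s' := by field_simp at h5; exact h5
  subst hq hs
  have hp : p = p' := by
    unfold liftT at h1; field_simp at h1
    exact mul_right_cancel₀ ha (by linarith)
  have hn : n = n' := by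
    unfold liftTX at h4; field_simp at h4
    exact mul_right_cancel₀ ha (by linarith)
  subst hp hn
  refine ⟨rfl, rfl, ?_, rfl, rfl⟩
  unfold liftTT at h3
  rw [div_left_inj' (pow_ne_zero 2 ha), sub_left_inj, div_left_inj' (pow_ne_zero 4 ha),
    add_left_inj] at h3
  have h6 := mul_left_cancel₀ hc (mul_right_cancel₀ ha h3)
  exact mul_right_cancel₀ ha (by linarith)

theorem injOn_equivalenceMap (hΩ : IsFibredDomain (extPt '' W))
    (hb : IsBaseParam (Prod.fst '' (extPt '' W)) T X₁ X₀) (hc : c₁ ≠ 0) :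
    InjOn (equivalenceMap T X₁ X₀ c₁ c₂) W := by
  intro e he e' he' h
  have hpt := (isPointTransformation_affineMap hΩ hb (U₁ := fun _ => c₁) (U₀ := fun _ => c₂)
    contDiffOn_const contDiffOn_const fun _ _ => hc).injOn ⟨e, he, rfl⟩ ⟨e', he', rfl⟩
    (congrArg extPt h)
  have ha := hb.X₁_ne_zero _ (mem_fst_image he)
  obtain ⟨⟨⟨z, p, q⟩, m, n, s⟩, b⟩ := e
  obtain ⟨⟨⟨z', p', q'⟩, m', n', s'⟩, b'⟩ := e'
  obtain rfl : z = z' := hpt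
  simp only [equivalenceMap, extPt, shift, Prod.mk.injEq, true_and] at h ha
  obtain ⟨⟨⟨h1, h2⟩, h3, h4, h5⟩, h6⟩ := h
  obtain ⟨rfl, rfl, rfl, rfl, rfl⟩ := fibre_eq_of_lift_eq hc ha h1 h2 h3 h4 h5
  have h7 := mul_left_cancel₀ (one_div_ne_zero ha) (sub_left_injective h6)
  rw [h7]

theorem fderiv_eq_of_affine_line {E F : Type*} [NormedAddCommGroup E] [NormedSpace ℝ E]
    [NormedAddCommGroup F] [NormedSpace ℝ F] {f : E → F} {x v : E} {w : F}
    (hf : DifferentiableAt ℝ f x) (h : ∀ c : ℝ, f (x + c • v) = f x + c • w) :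
    fderiv ℝ f x v = w := by
  have hl : HasDerivAt (fun c : ℝ => x + c • v) v 0 := by
    simpa using ((hasDerivAt_id (0 : ℝ)).smul_const v).const_add x
  have h2 := HasFDerivAt.comp_hasDerivAt (x := (0 : ℝ)) (f := fun c : ℝ => x + c • v)
    (l := f) (l' := fderiv ℝ f x) (by simpa using hf.hasFDerivAt) hl
  have h3 : HasDerivAt (fun c : ℝ => f x + c • w) w 0 := by
    simpa using ((hasDerivAt_id (0 : ℝ)).smul_const w).const_add (f x)
  refine h2.unique ?_
  rw [show f ∘ (fun c : ℝ => x + c • v) = fun c => f x + c • w from funext h]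
  exact h3

/-- The derivative of the `(t, x, u)`-components of `equivalenceMap`. -/
theorem extPt_fderiv_equivalenceMap (hW : IsOpen W) (hΩ : IsOpen (extPt '' W))
    (hb : IsBaseParam (Prod.fst '' (extPt '' W)) T X₁ X₀) {e : ExtJet} (he : e ∈ W) (v : ExtJet) :
    extPt (fderiv ℝ (equivalenceMap T X₁ X₀ c₁ c₂) e v) =
      (X₁ (extPt e).1 ^ 2 * (extPt v).1,
        shift X₁ X₀ e * (extPt v).1 + X₁ (extPt e).1 * (extPt v).2.1, c₁ * (extPt v).2.2) := by
  set Φ := affineMap T X₁ X₀ (fun _ => c₁) (fun _ => c₂) with hΦ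
  have hz : extPt e ∈ extPt '' W := ⟨e, he, rfl⟩
  have hs : ContDiffOn ℝ ∞ Φ (extPt '' W) :=
    contDiffOn_affineMap hb contDiffOn_const contDiffOn_const
  have pT := pd_compT_of_form (Φ := Φ) hΩ hb (fun _ _ => rfl) hz
  have pX := pd_compX_of_form (Φ := Φ) hΩ hb (fun _ _ => rfl) hz
  have pU := pd_compU_of_form (Φ := Φ) (U₁ := fun _ => c₁) (U₀ := fun _ => c₂) hΩ
    contDiffOn_const contDiffOn_const (fun _ _ => rfl) hz
  rw [extPt_fderiv (Φ := Φ) hW (contDiffOn_equivalenceMap (isOpen_fst_image hΩ) hb)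
    (fun _ _ => rfl) he, fderiv_apply_eq_comp (differentiableAt_of_contDiffOn hs hΩ hz)]
  obtain ⟨α, γ, δ⟩ := extPt v
  simp only [fderiv_pt_apply, pT, pX, pU]
  simp [shift, mul_comm]

/-- A kernel vector is vertical over `(t, x, u)`. In vertical directions the map is affine, with
linear part given by the same lift formulas, so `fibre_eq_of_lift_eq` compared with zero finishes
the proof. -/
theorem bijective_fderiv_equivalenceMap (hW : IsOpen W) (hΩ : IsOpen (extPt '' W))
    (hb : IsBaseParam (Prod.fst '' (extPt '' W)) T X₁ X₀) (hc : c₁ ≠ 0) {e : ExtJet}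
    (he : e ∈ W) : Function.Bijective (fderiv ℝ (equivalenceMap T X₁ X₀ c₁ c₂) e) := by
  refine bijective_of_ker_eq_zero fun v hv => ?_
  have ha := hb.X₁_ne_zero _ (mem_fst_image he)
  have hpt := extPt_fderiv_equivalenceMap (c₁ := c₁) (c₂ := c₂) hW hΩ hb he v
  rw [hv] at hpt
  obtain ⟨⟨⟨⟨v1, v2, v3⟩, vp, vq⟩, vm, vn, vs⟩, vb⟩ := v
  simp only [extPt, Prod.zero_eq_mk, Prod.mk.injEq] at hpt ha
  have h1 : v1 = 0 := by simpa [ha] using hpt.1.symm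
  have h2 : v2 = 0 := by simpa [ha, h1] using hpt.2.1.symm
  have h3 : v3 = 0 := by simpa [hc] using hpt.2.2.symm
  subst h1 h2 h3
  obtain ⟨⟨⟨⟨t, x, u⟩, p, q⟩, m, n, s⟩, b⟩ := e
  set S := deriv X₁ t * x + deriv X₀ t with hS
  set S' := deriv (deriv X₁) t * x + deriv (deriv X₀) t with hS'
  have hline := fderiv_eq_of_affine_line
    (v := (((((0, 0, 0), (vp, vq)), (vm, vn, vs)), vb) : ExtJet))
    (w := ((((0, 0, 0), (liftT c₁ (X₁ t) S vp vq, c₁ * vq / X₁ t)),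
      (liftTT c₁ (X₁ t) (deriv X₁ t) S S' vp vq vm vn vs,
        liftTX c₁ (X₁ t) (deriv X₁ t) S vq vn vs, c₁ * vs / X₁ t ^ 2)), 1 / X₁ t * vb))
    (differentiableAt_of_contDiffOn
      (contDiffOn_equivalenceMap (c₁ := c₁) (c₂ := c₂) (isOpen_fst_image hΩ) hb) hW he) (by
    intro k
    simp only [equivalenceMap, extPt, shift, liftT, liftTT, liftTX, Prod.smul_mk, Prod.mk_add_mk,
      smul_eq_mul, mul_zero, add_zero, Prod.mk.injEq, ← hS, ← hS']
    refine ⟨⟨⟨(add_zero _).symm, ?_, ?_⟩, ?_, ?_, ?_⟩, ?_⟩ <;> ring)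
  rw [hv] at hline
  simp only [Prod.zero_eq_mk, Prod.mk.injEq] at hline
  obtain ⟨⟨⟨-, k1, k2⟩, k3, k4, k5⟩, k6⟩ := hline
  obtain ⟨rfl, rfl, rfl, rfl, rfl⟩ := fibre_eq_of_lift_eq (a' := deriv X₁ t) (S := S) (S' := S')
    (p := 0) (q := 0) (m := 0) (n := 0) (s := 0) hc ha (by rw [← k1]; simp [liftT])
    (by rw [← k2]; simp) (by rw [← k3]; simp [liftTT, liftTX]) (by rw [← k4]; simp [liftTX])
    (by rw [← k5]; simp)
  have hvb : vb = 0 := by simpa [ha] using k6.symm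
  rw [hvb]
  rfl

theorem hasDerivAt_comp_time_line {h : ℝ → ℝ} {t : ℝ} (hh : DifferentiableAt ℝ h t) (v : ℝ) :
    HasDerivAt (fun k : ℝ => h (t + k * v)) (deriv h t * v) 0 := by
  have h1 : HasDerivAt (fun k : ℝ => t + k * v) v 0 := by
    simpa using ((hasDerivAt_id (0 : ℝ)).mul_const v).const_add t
  have h2 : HasDerivAt h (deriv h t) (t + 0 * v) := by simpa using hh.hasDerivAt
  exact h2.comp (0 : ℝ) h1

/-- Only `ũ_t̃` and `ũ_x̃` have to be differentiated, along the line through `e` in direction `v`;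
the formulas `liftTT` and `liftTX` are those making the results contact. -/
theorem contact_equivalenceMap (hW : IsOpen W) (hΩ : IsOpen (extPt '' W))
    (hb : IsBaseParam (Prod.fst '' (extPt '' W)) T X₁ X₀) {e : ExtJet} (he : e ∈ W) {v : ExtJet}
    (hv : v.1 ∈ cartan e.1) :
    (fderiv ℝ (equivalenceMap T X₁ X₀ c₁ c₂) e v).1 ∈
      cartan (equivalenceMap T X₁ X₀ c₁ c₂ e).1 := by
  have hI := isOpen_fst_image hΩ
  have ha := hb.X₁_ne_zero _ (mem_fst_image he)
  have hpt := extPt_fderiv_equivalenceMap (c₁ := c₁) (c₂ := c₂) hW hΩ hb he v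
  have hd := differentiableAt_of_contDiffOn
    (contDiffOn_equivalenceMap (c₁ := c₁) (c₂ := c₂) hI hb) hW he
  have dT := hd.fst.fst.snd.fst
  have dX := hd.fst.fst.snd.snd
  have eT : (fderiv ℝ (equivalenceMap T X₁ X₀ c₁ c₂) e v).1.1.2.1 =
      fderiv ℝ (fun e => (equivalenceMap T X₁ X₀ c₁ c₂ e).1.1.2.1) e v := by
    rw [hd.hasFDerivAt.fst.fst.snd.fst.fderiv]; rfl
  have eX : (fderiv ℝ (equivalenceMap T X₁ X₀ c₁ c₂) e v).1.1.2.2 =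
      fderiv ℝ (fun e => (equivalenceMap T X₁ X₀ c₁ c₂ e).1.1.2.2) e v := by
    rw [hd.hasFDerivAt.fst.fst.snd.snd.fderiv]; rfl
  have d₁ := differentiableAt_of_contDiffOn hb.smooth_X₁ hI (mem_fst_image he)
  have d₁' := differentiableAt_of_contDiffOn
    (hb.smooth_X₁.deriv_of_isOpen hI (m := ∞) (by simp)) hI (mem_fst_image he)
  have d₀' := differentiableAt_of_contDiffOn
    (hb.smooth_X₀.deriv_of_isOpen hI (m := ∞) (by simp)) hI (mem_fst_image he)
  obtain ⟨⟨⟨⟨v1, v2, v3⟩, vp, vq⟩, vm, vn, vs⟩, vb⟩ := v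
  obtain ⟨⟨⟨⟨t, x, u⟩, p, q⟩, m, n, s⟩, b⟩ := e
  simp only [extPt] at ha d₁ d₁' d₀'
  obtain ⟨hv1, hv2, hv3⟩ := hv
  simp only at hv1 hv2 hv3
  have lin : ∀ y w : ℝ, HasDerivAt (fun k : ℝ => y + k * w) w 0 := fun y w => by
    simpa using ((hasDerivAt_id (0 : ℝ)).mul_const w).const_add y
  have la := hasDerivAt_comp_time_line d₁ v1
  have lS := ((hasDerivAt_comp_time_line d₁' v1).fun_mul (lin x v2)).fun_add
    (hasDerivAt_comp_time_line d₀' v1)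
  have ha0 : X₁ (t + 0 * v1) ≠ 0 := by simpa using ha
  have kX := ((lin q vq).const_mul c₁).fun_div la ha0
  have kT := ((((lin p vp).fun_mul la).fun_sub ((lin q vq).fun_mul lS)).const_mul c₁).fun_div
    (la.fun_pow 3) (pow_ne_zero 3 ha0)
  have lX := fderiv_eq_of_hasDerivAt_line dX
    (v := ((((v1, v2, v3), (vp, vq)), (vm, vn, vs)), vb)) kX
  have lT := fderiv_eq_of_hasDerivAt_line dT
    (v := ((((v1, v2, v3), (vp, vq)), (vm, vn, vs)), vb)) kT
  refine ⟨?_, ?_, ?_⟩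
  · change (extPt _).2.2 = _ * (extPt _).1 + _ * (extPt _).2.1
    rw [hpt]
    simp only [equivalenceMap, extPt, shift, liftT]
    rw [hv1]
    field_simp
    ring
  · rw [eT, lT]
    change _ = _ * (extPt _).1 + _ * (extPt _).2.1
    rw [hpt]
    simp only [equivalenceMap, extPt, shift, liftTT, liftTX, zero_mul, add_zero]
    rw [hv2, hv3]
    field_simp
    ring
  · rw [eX, lX]
    change _ = _ * (extPt _).1 + _ * (extPt _).2.1
    rw [hpt]
    simp only [equivalenceMap, extPt, shift, liftTX, zero_mul, add_zero]
    rw [hv3]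
    field_simp
    ring

theorem isContactTransformation_equivalenceMap (hW : IsOpen W)
    (hΩ : IsFibredDomain (extPt '' W))
    (hb : IsBaseParam (Prod.fst '' (extPt '' W)) T X₁ X₀) (hc : c₁ ≠ 0) :
    IsContactTransformation (equivalenceMap T X₁ X₀ c₁ c₂) W where
  pointTransformation := ⟨hW, contDiffOn_equivalenceMap (isOpen_fst_image hΩ.isOpen) hb,
    injOn_equivalenceMap hΩ hb hc,
    fun _ he => bijective_fderiv_equivalenceMap hW hΩ.isOpen hb hc he⟩
  projectable_pt := ⟨affineMap T X₁ X₀ (fun _ => c₁) (fun _ => c₂), fun _ _ => rfl⟩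
  -- The jet components do not involve `B`, so any value may be inserted.
  projectable_jet := ⟨fun j => (equivalenceMap T X₁ X₀ c₁ c₂ (j, 0)).1, fun _ _ => rfl⟩
  contact := fun _ he _ hv => contact_equivalenceMap hW hΩ.isOpen hb he hv

theorem hasEquivalenceForm_equivalenceMap :
    HasEquivalenceForm W (equivalenceMap T X₁ X₀ c₁ c₂) T X₁ X₀ c₁ c₂ :=
  fun _ _ => ⟨rfl, rfl⟩

end Realization

end Kolmogorov

theorem mainTheorem11 (ε : ℝ) (hε : ε = 1 ∨ ε = -1) :
    -- which point transformations connect two given equations of the class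
    (∀ (Ω : Set Kolmogorov.Pt) (B B' : ℝ × ℝ → ℝ) (Φ : Kolmogorov.Pt → Kolmogorov.Pt),
      Kolmogorov.IsFibredDomain Ω →
      Kolmogorov.IsPointTransformation Φ Ω →
      ContDiffOn ℝ ∞ B (Kolmogorov.tx '' Ω) →
      ContDiffOn ℝ ∞ B' (Kolmogorov.tx '' (Φ '' Ω)) →
      (Kolmogorov.Connects ε Ω B Φ B' ↔
        ∃ (T X₁ X₀ : ℝ → ℝ) (U₁ U₀ : ℝ × ℝ → ℝ),
          Kolmogorov.IsBaseParam (Prod.fst '' Ω) T X₁ X₀ ∧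
          Kolmogorov.IsFibreParam ε B (Kolmogorov.tx '' Ω) U₁ U₀ ∧
          (∀ z ∈ Ω, Φ z = Kolmogorov.affineMap T X₁ X₀ U₁ U₀ z) ∧
          ∀ t x : ℝ, (t, x) ∈ Kolmogorov.tx '' Ω →
            B' (T t, X₁ t * x + X₀ t) =
              1 / X₁ t * (B (t, x) - 2 * ε * (fderiv ℝ U₁ (t, x) (0, 1) / U₁ (t, x))) -
                (deriv X₁ t * x + deriv X₀ t) / X₁ t ^ 2)) ∧
    -- the parameters are arbitrary: all their admitted values are realized
    (∀ (Ω : Set Kolmogorov.Pt) (B : ℝ × ℝ → ℝ) (T X₁ X₀ : ℝ → ℝ) (U₁ U₀ : ℝ × ℝ → ℝ),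
      Kolmogorov.IsFibredDomain Ω →
      ContDiffOn ℝ ∞ B (Kolmogorov.tx '' Ω) →
      Kolmogorov.IsBaseParam (Prod.fst '' Ω) T X₁ X₀ →
      Kolmogorov.IsFibreParam ε B (Kolmogorov.tx '' Ω) U₁ U₀ →
      ∃ B' : ℝ × ℝ → ℝ,
        Kolmogorov.IsAdmissible ε Ω B (Kolmogorov.affineMap T X₁ X₀ U₁ U₀) B') ∧
    -- the form of the transformations in the equivalence group
    (∀ (W : Set Kolmogorov.ExtJet) (𝒯 : Kolmogorov.ExtJet → Kolmogorov.ExtJet),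
      Kolmogorov.IsExtDomain ε W →
      (Kolmogorov.IsEquivalenceTransformation ε W 𝒯 ↔
        Kolmogorov.IsContactTransformation 𝒯 W ∧
        ∃ (T X₁ X₀ : ℝ → ℝ) (c₁ c₂ : ℝ),
          Kolmogorov.IsBaseParam (Prod.fst '' (Kolmogorov.extPt '' W)) T X₁ X₀ ∧
          c₁ ≠ 0 ∧
          Kolmogorov.HasEquivalenceForm W 𝒯 T X₁ X₀ c₁ c₂)) ∧
    -- again, all admitted values of the parameters are realized
    (∀ (W : Set Kolmogorov.ExtJet) (T X₁ X₀ : ℝ → ℝ) (c₁ c₂ : ℝ),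
      Kolmogorov.IsExtDomain ε W →
      Kolmogorov.IsBaseParam (Prod.fst '' (Kolmogorov.extPt '' W)) T X₁ X₀ →
      c₁ ≠ 0 →
      ∃ 𝒯 : Kolmogorov.ExtJet → Kolmogorov.ExtJet,
        Kolmogorov.IsEquivalenceTransformation ε W 𝒯 ∧
        Kolmogorov.HasEquivalenceForm W 𝒯 T X₁ X₀ c₁ c₂) := by
  have hε2 : ε ^ 2 = 1 := by rcases hε with rfl | rfl <;> norm_num
  refine ⟨fun Ω B B' Φ hΩ hΦ _ _ => Kolmogorov.connects_iff hε2 hΩ hΦ,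
    fun Ω B T X₁ X₀ U₁ U₀ hΩ hB hb hf =>
      Kolmogorov.exists_isAdmissible_affineMap hε2 hΩ hB hb hf,
    fun W 𝒯 hW => Kolmogorov.isEquivalenceTransformation_iff hε2 hW,
    fun W T X₁ X₀ c₁ c₂ hW hb hc => ?_⟩
  have hcon := Kolmogorov.isContactTransformation_equivalenceMap (c₂ := c₂) hW.isOpen hW.fibred
    hb hc
  have hform := Kolmogorov.hasEquivalenceForm_equivalenceMap (W := W) (T := T) (X₁ := X₁)
    (X₀ := X₀) (c₁ := c₁) (c₂ := c₂)
  exact ⟨_, ⟨hcon, Kolmogorov.preservesClass_of_form hε2 hW hcon hb hc hform⟩, hform⟩
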